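/- Let $M\ge 2$ be an integer and $p\in[0,1]$. Label each node $i_1\dots i_n$ of the $M$-adic tree ($n\ge 0$, $i_k\in\{0,\dots,M-1\}$) by $X_{i_1\dots i_n}\in\{0,1\}$, where the labels are independent, $X_\emptyset=1$ almost surely, and $\mathbb P(X_{i_1\dots i_n}=1)=p$ for $n\ge 1$. Put $$I_{i_1\dots i_n}=\Big[\sum_{k=1}^n\frac{i_k}{M^k},\ \sum_{k=1}^n\frac{i_k}{M^k}+\frac1{M^n}\Big],\qquad S_n=\{i_1\dots i_n:\ X_{i_1}=X_{i_1i_2}=\dots=X_{i_1\dots i_n}=1\},$$ and let $F=\bigcap_{n\ge1}\bigcup_{i_1\dots i_n\in S_n}I_{i_1\dots i_n}$ (Mandelbrot percolation on the line). Let $F_1,F_2$ be two independent copies of $F$, and let $F_2-F_1=\{y-x: x\in F_1,\ y\in F_2\}$. Then almost surely on the event that $F_1$ and $F_2$ are both nonempty the following hold: 1. if $\dim_{\rm H}F_1+\dim_{\rm H}F_2<1$, then $F_2-F_1$ contains no interval of positive length; 2. if $\dim_{\rm H}F_1+\dim_{\rm H}F_2>1$, then $F_2-F_1$ contains an interval of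 positive length. -/

import Mathlib

open scoped Pointwise

/-- A labelling of the `M`-adic tree by `1 = true` and `0 = false`. The nodes `i₁ … iₙ` of the tree
are the lists over `Fin M`; the root is the empty list. -/
abbrev LabeledTree (M : ℕ) : Type := List (Fin M) → Bool

/-- The probability that a node carries the label `1`: it is `1` at the root and `p_{iₙ}` at
`i₁ … iₙ`. -/
def nodeProb {M : ℕ} (p : Fin M → unitInterval) (v : List (Fin M)) : unitInterval :=
  match v.getLast? with
  | none => 1
  | some i => p i

/-- The law of the labelled tree: the labels are independent Bernoulli variables with success
probabilities `nodeProb p`. -/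
noncomputable def treeMeasure {M : ℕ} (p : Fin M → unitInterval) :
    MeasureTheory.Measure (LabeledTree M) :=
  MeasureTheory.Measure.infinitePi fun v : List (Fin M) =>
    ProbabilityTheory.bernoulliMeasure true false (nodeProb p v)

/-- The left end point `i₁ / M + i₂ / M² + ⋯ + iₙ / Mⁿ`. -/
noncomputable def leftEnd {M : ℕ} (v : List (Fin M)) : ℝ :=
  ∑ k : Fin v.length, ((v.get k : ℕ) : ℝ) / (M : ℝ) ^ ((k : ℕ) + 1)

/-- The `M`-adic interval of length `M⁻ⁿ` coded by `i₁ … iₙ`. -/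
noncomputable def madicInterval {M : ℕ} (v : List (Fin M)) : Set ℝ :=
  Set.Icc (leftEnd v) (leftEnd v + 1 / (M : ℝ) ^ v.length)

/-- `Sₙ`: the strings `i₁ … iₙ` with `X_{i₁} = X_{i₁ i₂} = ⋯ = X_{i₁ … iₙ} = 1`. -/
def survivors {M : ℕ} (X : LabeledTree M) (n : ℕ) : Set (List (Fin M)) :=
  {v | v.length = n ∧ ∀ u : List (Fin M), u ≠ [] → u <+: v → X u = true}

/-- The `n`-th level approximation `Fⁿ`. -/
noncomputable def levelSet {M : ℕ} (X : LabeledTree M) (n : ℕ) : Set ℝ :=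
  ⋃ v ∈ survivors X n, madicInterval v

/-- The random Cantor set `F = ⋂_{n ≥ 1} Fⁿ`. -/
noncomputable def randomCantorSet {M : ℕ} (X : LabeledTree M) : Set ℝ :=
  ⋂ n : ℕ, ⋂ _ : 1 ≤ n, levelSet X n

/-- The set contains a nondegenerate interval. -/
def ContainsInterval (A : Set ℝ) : Prop :=
  ∃ a b : ℝ, a < b ∧ Set.Icc a b ⊆ A

/-! Everything is decided by the size of `M p²` relative to `1`, since on survival each set has
dimension `1 + log p / log M`, which exceeds `1/2` exactly when `M p² > 1`.

Upper bounds are first moments: at most `(M p)ⁿ` intervals of level `n` are expected to survive, so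
`M⁻ⁿˢ #Sₙ → 0` almost surely once `M¹⁻ˢ p < 1` (`ae_tendsto_pow_mul_ncard_survivors`). This bounds
the dimension, and for `M p² < 1` one may take `s = 1/2`: the difference set is covered by `#Sₙ(X)
#Sₙ(Y)` intervals of length `2 M⁻ⁿ`, hence is Lebesgue null.

For parameters with `M p q > 1`, count the pairs of surviving level-`n` intervals at offset `k /
Mⁿ`. Distinct pairs with the same offset share no node, so their children are independent, and
Hoeffding's bound makes these counts grow by a factor larger than `1`, simultaneously for all
offsets in a fixed real interval, with positive probability
(`exists_forestMeasure_iInter_richForests_ne_zero`). By compactness that interval then lies in the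
difference set (`Icc_subset_randomCantorSet_sub`). Independence of the subtrees upgrades positive
probability to almost surely on survival (`ae_exists_graft_mem`).

The same theorem gives the lower bound on dimension. Take `q = M⁻ˢ` with `M p q > 1`: the difference
set contains `0` with positive probability, so the `p`-set meets an independent `q`-set. But the
`q`-set almost surely misses any fixed set of dimension below `s`, because it hits a small set `U`
with probability at most `C (diam U)ˢ` (`hittingMeasure_eq_zero_of_dimH_lt`).

At `M p² = 1` both dimensions are `1/2`, so neither hypothesis of the theorem holds. -/

namespace MandelbrotPercolation

open MeasureTheory ProbabilityTheory
open scoped ENNReal NNReal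

variable {M : ℕ}

/-! ### Codes of `M`-adic intervals -/

/-- The integer with base `M` digits `i₁ … iₙ`. -/
def index (v : List (Fin M)) : ℕ := v.foldl (fun a i => M * a + i) 0

@[simp] lemma index_nil : index ([] : List (Fin M)) = 0 := rfl

@[simp] lemma index_concat (v : List (Fin M)) (i : Fin M) :
    index (v ++ [i]) = M * index v + i := by
  simp [index]

@[simp] lemma leftEnd_nil : leftEnd ([] : List (Fin M)) = 0 := by
  simp [leftEnd]

lemma leftEnd_cons (i : Fin M) (v : List (Fin M)) :
    leftEnd (i :: v) = ((i : ℕ) : ℝ) / M + leftEnd v / M := by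
  simp only [leftEnd, List.length_cons]
  rw [Fin.sum_univ_succ, Finset.sum_div]
  simp [pow_succ, div_div]

lemma leftEnd_append (v u : List (Fin M)) :
    leftEnd (v ++ u) = leftEnd v + leftEnd u / (M : ℝ) ^ v.length := by
  induction v with
  | nil => simp
  | cons i v ih =>
    rw [List.cons_append, leftEnd_cons, leftEnd_cons, ih, List.length_cons, pow_succ, add_div,
      div_div, add_assoc]

lemma leftEnd_eq_index_div (hM : 0 < M) (v : List (Fin M)) :
    leftEnd v = (index v : ℝ) / (M : ℝ) ^ v.length := by
  have hM' : (M : ℝ) ≠ 0 := by positivity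
  induction v using List.reverseRecOn with
  | nil => simp
  | append_singleton v i ih =>
    rw [leftEnd_append, leftEnd_cons, ih]
    simp only [leftEnd_nil, index_concat, List.length_append, List.length_singleton, pow_succ]
    push_cast
    field_simp
    ring

lemma index_lt (v : List (Fin M)) : index v < M ^ v.length := by
  induction v using List.reverseRecOn with
  | nil => simp
  | append_singleton v i ih =>
    rw [index_concat, List.length_append, List.length_singleton, pow_succ]
    have := i.2
    nlinarith

lemma index_injective_of_length_eq {v w : List (Fin M)} (hl : v.length = w.length)
    (h : index v = index w) : v = w := by
  induction v using List.reverseRecOn generalizing w with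
  | nil => exact (List.length_eq_zero_iff.1 hl.symm).symm
  | append_singleton v i ih =>
    obtain rfl | ⟨w, j, rfl⟩ := w.eq_nil_or_concat'
    · simp at hl
    rw [index_concat, index_concat] at h
    have hM : 0 < M := i.pos
    have hij : (i : ℕ) = j := by
      have := congrArg (· % M) h
      simpa [Nat.mul_add_mod, Nat.mod_eq_of_lt] using this
    have hvw : index v = index w := by
      rw [hij] at h
      exact Nat.eq_of_mul_eq_mul_left hM (Nat.add_right_cancel h)
    rw [ih (by simpa using hl) hvw, Fin.ext hij]

lemma exists_index_eq (n a : ℕ) (ha : a < M ^ n) :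
    ∃ v : List (Fin M), v.length = n ∧ index v = a := by
  induction n generalizing a with
  | zero => exact ⟨[], rfl, by simp at ha; simp [ha]⟩
  | succ n ih =>
    have hM : 0 < M := by
      rcases Nat.eq_zero_or_pos M with rfl | h
      · simp at ha
      · exact h
    obtain ⟨v, hv, hva⟩ := ih (a / M) (Nat.div_lt_of_lt_mul (by rwa [pow_succ, mul_comm] at ha))
    exact ⟨v ++ [⟨a % M, Nat.mod_lt _ hM⟩], by simp [hv], by simp [hva, Nat.div_add_mod]⟩

lemma leftEnd_nonneg (v : List (Fin M)) : 0 ≤ leftEnd v := by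
  unfold leftEnd; positivity

lemma leftEnd_add_le_one (hM : 0 < M) (v : List (Fin M)) :
    leftEnd v + 1 / (M : ℝ) ^ v.length ≤ 1 := by
  rw [leftEnd_eq_index_div hM, ← add_div, div_le_one (by positivity)]
  exact_mod_cast index_lt v

lemma madicInterval_append_subset (hM : 0 < M) (v u : List (Fin M)) :
    madicInterval (v ++ u) ⊆ madicInterval v := by
  have hM' : (0 : ℝ) < (M : ℝ) ^ v.length := by positivity
  have h0 := leftEnd_nonneg u
  have h1 := leftEnd_add_le_one hM u
  have h2 : leftEnd u / (M : ℝ) ^ v.length + 1 / (M : ℝ) ^ (v ++ u).length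
      = (leftEnd u + 1 / (M : ℝ) ^ u.length) / (M : ℝ) ^ v.length := by
    rw [List.length_append, pow_add]
    field_simp
  apply Set.Icc_subset_Icc
  · rw [leftEnd_append]
    have : 0 ≤ leftEnd u / (M : ℝ) ^ v.length := by positivity
    linarith
  · rw [leftEnd_append, add_assoc, h2]
    gcongr

/-! ### Survivors and level sets -/

lemma mem_survivors_concat {X : LabeledTree M} {n : ℕ} {v : List (Fin M)} {i : Fin M} :
    v ++ [i] ∈ survivors X (n + 1) ↔ v ∈ survivors X n ∧ X (v ++ [i]) = true := by
  constructor
  · rintro ⟨hl, h⟩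
    exact ⟨⟨by simpa using hl, fun u hu huv => h u hu (huv.trans (List.prefix_append _ _))⟩,
      h _ (by simp) List.prefix_rfl⟩
  · rintro ⟨⟨hl, h⟩, hX⟩
    refine ⟨by simp [hl], fun u hu huv => ?_⟩
    rcases List.prefix_concat_iff.1 (by simpa using huv) with h' | h'
    · rw [h']; simpa using hX
    · exact h u hu h'

lemma take_mem_survivors {X : LabeledTree M} {m n : ℕ} (hmn : m ≤ n) {v : List (Fin M)}
    (hv : v ∈ survivors X n) : v.take m ∈ survivors X m :=
  ⟨by simp [hv.1, hmn], fun u hu huv => hv.2 u hu (huv.trans (List.take_prefix _ _))⟩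

lemma survivors_congr {X Y : LabeledTree M} {n : ℕ}
    (h : ∀ u : List (Fin M), u ≠ [] → u.length ≤ n → X u = Y u) :
    survivors X n = survivors Y n := by
  ext v
  refine and_congr_right fun hl => forall_congr' fun u => forall_congr' fun hu =>
    forall_congr' fun huv => ?_
  rw [h u hu (hl ▸ huv.length_le)]

lemma finite_survivors (X : LabeledTree M) (n : ℕ) : (survivors X n).Finite :=
  (List.finite_length_eq (Fin M) n).subset fun _ hv => hv.1

lemma levelSet_antitone (hM : 0 < M) (X : LabeledTree M) : Antitone (levelSet X) := by
  intro m n hmn x hx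
  simp only [levelSet, Set.mem_iUnion, exists_prop] at hx ⊢
  obtain ⟨v, hv, hx⟩ := hx
  refine ⟨v.take m, take_mem_survivors hmn hv, ?_⟩
  rw [← List.take_append_drop m v] at hx
  exact madicInterval_append_subset hM _ _ hx

lemma isClosed_levelSet (X : LabeledTree M) (n : ℕ) : IsClosed (levelSet X n) :=
  (finite_survivors X n).isClosed_biUnion fun _ _ => isClosed_Icc

lemma levelSet_subset_Icc (hM : 0 < M) (X : LabeledTree M) (n : ℕ) :
    levelSet X n ⊆ Set.Icc 0 1 := by
  refine Set.iUnion₂_subset fun v _ => Set.Icc_subset_Icc (leftEnd_nonneg v) ?_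
  exact leftEnd_add_le_one hM v

lemma leftEnd_mem_levelSet {X : LabeledTree M} {n : ℕ} {v : List (Fin M)}
    (hv : v ∈ survivors X n) : leftEnd v ∈ levelSet X n :=
  Set.mem_biUnion hv ⟨le_rfl, le_add_of_nonneg_right (by positivity)⟩

lemma mem_randomCantorSet_of_frequently (hM : 0 < M) {X : LabeledTree M} {x : ℝ}
    (h : ∀ n, ∃ m ≥ n, x ∈ levelSet X m) : x ∈ randomCantorSet X := by
  simp only [randomCantorSet, Set.mem_iInter]
  intro n _
  obtain ⟨m, hm, hx⟩ := h n
  exact levelSet_antitone hM X hm hx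

lemma randomCantorSet_subset_levelSet (hM : 0 < M) (X : LabeledTree M) (n : ℕ) :
    randomCantorSet X ⊆ levelSet X n := fun _ hx =>
  levelSet_antitone hM X n.le_succ (Set.mem_iInter₂.1 hx (n + 1) (by omega))

lemma survivors_nonempty_of_randomCantorSet (hM : 0 < M) {X : LabeledTree M}
    (h : (randomCantorSet X).Nonempty) (n : ℕ) : (survivors X n).Nonempty := by
  obtain ⟨x, hx⟩ := h
  have := randomCantorSet_subset_levelSet hM X n hx
  simp only [levelSet, Set.mem_iUnion] at this
  obtain ⟨v, hv, _⟩ := this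
  exact ⟨v, hv⟩

/-- The embedding of the nodes of the tree onto the subtree below `v` that fixes the root. -/
def graft (v u : List (Fin M)) : List (Fin M) := if u = [] then [] else v ++ u

lemma graft_injective (v : List (Fin M)) : Function.Injective (graft v) := by
  intro a b h
  unfold graft at h
  split_ifs at h with h1 h2 h2
  · rw [h1, h2]
  · exact absurd (List.append_eq_nil_iff.1 h.symm).2 h2
  · exact absurd (List.append_eq_nil_iff.1 h).2 h1
  · exact List.append_cancel_left h

lemma append_mem_survivors {X : LabeledTree M} {n m : ℕ} {v u : List (Fin M)}
    (hv : v ∈ survivors X n) (hu : u ∈ survivors (fun u => X (graft v u)) m) :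
    v ++ u ∈ survivors X (n + m) := by
  refine ⟨by simp [hv.1, hu.1], fun w hw hwu => ?_⟩
  rcases List.prefix_or_prefix_of_prefix hwu (List.prefix_append v u) with h | ⟨w', rfl⟩
  · exact hv.2 w hw h
  · rcases eq_or_ne w' [] with rfl | hw'
    · exact hv.2 _ hw (by simp)
    · have := hu.2 w' hw' (by simpa using hwu)
      simpa [graft, hw'] using this

/-- Self-similarity, in the one direction needed: large dimension and intervals in the difference
set pass from a subtree to the whole tree. -/
lemma image_randomCantorSet_graft_subset (hM : 0 < M) {X : LabeledTree M} {n : ℕ}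
    {v : List (Fin M)} (hv : v ∈ survivors X n) :
    (fun x : ℝ => leftEnd v + x / (M : ℝ) ^ n) '' randomCantorSet (fun u => X (graft v u))
      ⊆ randomCantorSet X := by
  rintro _ ⟨x, hx, rfl⟩
  refine mem_randomCantorSet_of_frequently hM fun m => ⟨n + m, by omega, ?_⟩
  have hx := randomCantorSet_subset_levelSet hM _ m hx
  simp only [levelSet, Set.mem_iUnion, exists_prop] at hx ⊢
  obtain ⟨u, hu, hx⟩ := hx
  refine ⟨v ++ u, append_mem_survivors hv hu, ?_⟩
  have hM' : (0 : ℝ) < (M : ℝ) ^ n := by positivity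
  rw [madicInterval, leftEnd_append, List.length_append, hv.1, pow_add, add_assoc, ← div_div,
    div_right_comm, ← add_div]
  constructor
  · have := div_le_div_of_nonneg_right hx.1 hM'.le
    simpa using this
  · have := div_le_div_of_nonneg_right hx.2 hM'.le
    simpa using this

lemma dimH_randomCantorSet_graft_le (hM : 0 < M) {X : LabeledTree M} {n : ℕ}
    {v : List (Fin M)} (hv : v ∈ survivors X n) :
    dimH (randomCantorSet fun u => X (graft v u)) ≤ dimH (randomCantorSet X) := by
  refine le_trans ?_ (dimH_mono (image_randomCantorSet_graft_subset hM hv))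
  have hM' : (0 : ℝ) < (M : ℝ) ^ n := by positivity
  have : AntilipschitzWith ((M : NNReal) ^ n) fun x : ℝ => leftEnd v + x / (M : ℝ) ^ n := by
    refine AntilipschitzWith.of_le_mul_dist fun x y => ?_
    simp only [dist_add_left, Real.dist_eq, ← sub_div, abs_div, abs_of_pos hM']
    push_cast
    rw [mul_div_cancel₀ _ hM'.ne']
  exact this.le_dimH_image _

/-- Since `v` and `w` have the same level, both subtrees are scaled by `M⁻ⁿ`, and differences are
mapped by a single similarity. -/
lemma containsInterval_sub_of_graft (hM : 0 < M) {X Y : LabeledTree M} {n : ℕ}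
    {v w : List (Fin M)} (hv : v ∈ survivors X n) (hw : w ∈ survivors Y n)
    (h : ContainsInterval (randomCantorSet (fun u => Y (graft w u)) -
      randomCantorSet fun u => X (graft v u))) :
    ContainsInterval (randomCantorSet Y - randomCantorSet X) := by
  obtain ⟨a, b, hab, h⟩ := h
  have hM' : (0 : ℝ) < (M : ℝ) ^ n := by positivity
  refine ⟨leftEnd w - leftEnd v + a / (M : ℝ) ^ n, leftEnd w - leftEnd v + b / (M : ℝ) ^ n,
    by gcongr, fun t ht => ?_⟩
  have : (t - (leftEnd w - leftEnd v)) * (M : ℝ) ^ n ∈ Set.Icc a b := by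
    constructor
    · rw [← div_le_iff₀ hM']; linarith [ht.1]
    · rw [← le_div_iff₀ hM']; linarith [ht.2]
  obtain ⟨y, hy, x, hx, hxy⟩ := h this
  refine ⟨_, image_randomCantorSet_graft_subset hM hw ⟨y, hy, rfl⟩, _,
    image_randomCantorSet_graft_subset hM hv ⟨x, hx, rfl⟩, ?_⟩
  have hxy' : y - x = (t - (leftEnd w - leftEnd v)) * (M : ℝ) ^ n := hxy
  have : y / (M : ℝ) ^ n - x / (M : ℝ) ^ n = t - (leftEnd w - leftEnd v) := by
    rw [← sub_div, hxy', mul_div_cancel_right₀ _ hM'.ne']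
  show leftEnd w + y / (M : ℝ) ^ n - (leftEnd v + x / (M : ℝ) ^ n) = t
  linarith

/-! ### Product measures -/

section InfinitePi

variable {ι κ α : Type*} [MeasurableSpace α]

/-- Replacing the coordinates outside a set by independent copies does not change the law. -/
lemma map_resample_infinitePi (μ : ι → Measure α) [∀ i, IsProbabilityMeasure (μ i)] (A : ι → Prop)
    [DecidablePred A] :
    ((Measure.infinitePi μ).prod (Measure.infinitePi μ)).map
      (fun z i => if A i then z.1 i else z.2 i) = Measure.infinitePi μ := by
  refine Measure.eq_infinitePi μ fun s t ht => ?_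
  have hm : Measurable fun (z : (ι → α) × (ι → α)) i => if A i then z.1 i else z.2 i := by
    refine measurable_pi_lambda _ fun i => ?_
    split_ifs
    · exact (measurable_pi_apply i).comp measurable_fst
    · exact (measurable_pi_apply i).comp measurable_snd
  rw [Measure.map_apply hm (.pi s.countable_toSet fun i _ => ht i)]
  have : (fun (z : (ι → α) × (ι → α)) i => if A i then z.1 i else z.2 i) ⁻¹' (Set.pi s t)
      = Set.pi (s.filter A) t ×ˢ Set.pi (s.filter (¬ A ·)) t := by
    ext z
    simp only [Set.mem_preimage, Set.mem_pi, Set.mem_prod, Finset.coe_filter, Set.mem_ofPred_eq,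
      and_imp, Finset.mem_coe]
    constructor
    · intro h
      exact ⟨fun i hi hA => by simpa [hA] using h i hi, fun i hi hA => by simpa [hA] using h i hi⟩
    · rintro ⟨h1, h2⟩ i hi
      split_ifs with hA
      · exact h1 i hi hA
      · exact h2 i hi hA
  rw [this, Measure.prod_prod, Measure.infinitePi_pi μ fun i _ => ht i,
    Measure.infinitePi_pi μ fun i _ => ht i, Finset.prod_filter_mul_prod_filter_not]

/-- Turns a pair of independent trees into one product measure, so that cylinders and resampling
treat both trees at once. -/
lemma map_sumElim_infinitePi (μ : ι → Measure α) (ν : κ → Measure α)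
    [∀ i, IsProbabilityMeasure (μ i)] [∀ i, IsProbabilityMeasure (ν i)] :
    ((Measure.infinitePi μ).prod (Measure.infinitePi ν)).map
      (fun z => (Sum.elim z.1 z.2 : ι ⊕ κ → α)) = Measure.infinitePi (Sum.elim μ ν) := by
  have : ∀ i, IsProbabilityMeasure (Sum.elim μ ν i) := by
    rintro (i | i) <;> simp <;> infer_instance
  refine Measure.eq_infinitePi (Sum.elim μ ν) fun s t ht => ?_
  have hm : Measurable fun z : (ι → α) × (κ → α) => (Sum.elim z.1 z.2 : ι ⊕ κ → α) := by
    refine measurable_pi_lambda _ ?_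
    rintro (i | i)
    · exact (measurable_pi_apply i).comp measurable_fst
    · exact (measurable_pi_apply i).comp measurable_snd
  rw [Measure.map_apply hm (.pi s.countable_toSet fun i _ => ht i)]
  have : (fun z : (ι → α) × (κ → α) => (Sum.elim z.1 z.2 : ι ⊕ κ → α)) ⁻¹' (Set.pi s t)
      = Set.pi s.toLeft (fun i => t (.inl i)) ×ˢ Set.pi s.toRight (fun i => t (.inr i)) := by
    ext z
    simp [Set.mem_pi, Sum.forall]
  rw [this, Measure.prod_prod, Measure.infinitePi_pi μ fun i _ => ht _,
    Measure.infinitePi_pi ν fun i _ => ht _]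
  conv_rhs => rw [← Finset.toLeft_disjSum_toRight (u := s), Finset.prod_disjSum]
  simp

/-- If conditionally on every finite-coordinate event inside `S` the event `E` has probability at
least `c > 0`, then `E` has full measure in `S`. -/
lemma measure_diff_eq_zero_of_cylinder (μ : ι → Measure α)
    [∀ i, IsProbabilityMeasure (μ i)] {S E : Set (ι → α)} (hS : MeasurableSet S)
    (hE : MeasurableSet E) {c : ℝ≥0∞} (hc : c ≠ 0) (hc' : c ≠ ∞)
    (h : ∀ B ∈ measurableCylinders (fun _ : ι => α),
      c * Measure.infinitePi μ (B ∩ S) ≤ Measure.infinitePi μ (B ∩ E)) :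
    Measure.infinitePi μ (S \ E) = 0 := by
  set P := Measure.infinitePi μ
  have hring : IsSetRing (measurableCylinders fun _ : ι => α) :=
    { empty_mem := empty_mem_measurableCylinders _
      union_mem := fun _ _ => union_mem_measurableCylinders
      sdiff_mem := fun _ _ => sdiff_mem_measurableCylinders }
  have key : ∀ ε : ℝ≥0∞, 0 < ε → c * P (S \ E) ≤ (1 + c) * ε := by
    intro ε hε
    -- A cylinder `B` close to `S \ E` barely meets `E`, yet the hypothesis forces it to meet `E` in
    -- at least the fraction `c` of `B ∩ S`.
    obtain ⟨B, hB, hBε⟩ := exists_measure_symmDiff_lt_of_generateFrom_isSetRing (μ := P) hring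
      ⟨{Set.univ}, Set.countable_singleton _,
        Set.singleton_subset_iff.2 (univ_mem_measurableCylinders _), by simp⟩
      generateFrom_measurableCylinders.symm (hS.diff hE) hε
    have h1 : P (S \ E) ≤ P (B ∩ S) + ε := by
      calc P (S \ E) ≤ P ((B ∩ S) ∪ symmDiff B (S \ E)) := measure_mono fun x hx => by
            by_cases hxB : x ∈ B
            · exact .inl ⟨hxB, hx.1⟩
            · exact .inr (.inr ⟨hx, hxB⟩)
        _ ≤ P (B ∩ S) + ε := (measure_union_le _ _).trans (by gcongr)
    have h2 : P (B ∩ E) ≤ ε :=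
      (measure_mono fun x hx => Or.inl ⟨hx.1, fun hx' => hx'.2 hx.2⟩).trans hBε.le
    calc c * P (S \ E) ≤ c * (P (B ∩ S) + ε) := by gcongr
      _ = c * P (B ∩ S) + c * ε := mul_add _ _ _
      _ ≤ ε + c * ε := by gcongr; exact (h B hB).trans h2
      _ = (1 + c) * ε := by rw [add_mul, one_mul]
  have h0 : c * P (S \ E) = 0 := by
    by_contra hne
    have hfin : 1 + c ≠ ∞ := by simp [hc']
    have hpos : 0 < c * P (S \ E) / (1 + c) / 2 :=
      ENNReal.div_pos (ENNReal.div_pos hne hfin).ne' (by simp)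
    have hlt := key _ hpos
    rw [← mul_div_assoc, ENNReal.mul_div_cancel (by simp) hfin] at hlt
    have hfin' : c * P (S \ E) ≠ ∞ := ENNReal.mul_ne_top hc' (measure_ne_top _ _)
    exact absurd hlt (not_le.2 (ENNReal.half_lt_self hne hfin'))
  exact (mul_eq_zero.1 h0).resolve_left hc

end InfinitePi

/-! ### Pairs of trees -/

/-- A pair of labelled trees. -/
abbrev LabeledForest (M : ℕ) : Type := List (Fin M) ⊕ List (Fin M) → Bool

/-- The law of a node of a pair of independent trees with parameters `p` and `q`. -/
noncomputable def forestNodeMeasure (p q : unitInterval) :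
    List (Fin M) ⊕ List (Fin M) → Measure Bool :=
  Sum.elim (fun v => bernoulliMeasure true false (nodeProb (fun _ : Fin M => p) v))
    (fun v => bernoulliMeasure true false (nodeProb (fun _ : Fin M => q) v))

instance (p q : unitInterval) (x : List (Fin M) ⊕ List (Fin M)) :
    IsProbabilityMeasure (forestNodeMeasure p q x) := by
  rcases x with x | x <;> simp only [forestNodeMeasure, Sum.elim_inl, Sum.elim_inr] <;>
    infer_instance

/-- The law of a pair of independent trees with parameters `p` and `q`. -/
noncomputable def forestMeasure (M : ℕ) (p q : unitInterval) : Measure (LabeledForest M) :=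
  Measure.infinitePi (forestNodeMeasure p q)

instance (p q : unitInterval) : IsProbabilityMeasure (forestMeasure M p q) := by
  unfold forestMeasure; infer_instance

/-- The first tree. -/
abbrev LabeledForest.left (ω : LabeledForest M) : LabeledTree M := fun v => ω (.inl v)

/-- The second tree. -/
abbrev LabeledForest.right (ω : LabeledForest M) : LabeledTree M := fun v => ω (.inr v)

lemma measurable_left : Measurable (LabeledForest.left (M := M)) :=
  measurable_pi_lambda _ fun _ => measurable_pi_apply _

lemma measurable_right : Measurable (LabeledForest.right (M := M)) :=
  measurable_pi_lambda _ fun _ => measurable_pi_apply _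

lemma measurable_sumElim :
    Measurable fun X : LabeledTree M × LabeledTree M => (Sum.elim X.1 X.2 : LabeledForest M) := by
  refine measurable_pi_lambda _ ?_
  rintro (i | i)
  · exact (measurable_pi_apply i).comp measurable_fst
  · exact (measurable_pi_apply i).comp measurable_snd

lemma map_sumElim_treeMeasure (p q : unitInterval) :
    ((treeMeasure fun _ : Fin M => p).prod (treeMeasure fun _ : Fin M => q)).map
      (fun X => (Sum.elim X.1 X.2 : LabeledForest M)) = forestMeasure M p q :=
  map_sumElim_infinitePi _ _

/-- The label law only distinguishes the root from the other nodes. Because `graft` fixes the root,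
the grafted tree has exactly the original law. -/
lemma nodeProb_graft (p : unitInterval) (v u : List (Fin M)) :
    nodeProb (fun _ : Fin M => p) (graft v u) = nodeProb (fun _ : Fin M => p) u := by
  unfold graft
  split_ifs with h
  · rw [h]
  · obtain ⟨u, i, rfl⟩ := u.eq_nil_or_concat'.resolve_left h
    simp [nodeProb, ← List.append_assoc]

/-- The pair of subtrees below `v` and `w`. -/
def LabeledForest.graft (v w : List (Fin M)) (ω : LabeledForest M) : LabeledForest M :=
  fun x => ω (Sum.map (MandelbrotPercolation.graft v) (MandelbrotPercolation.graft w) x)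

lemma left_graft (v w : List (Fin M)) (ω : LabeledForest M) :
    (ω.graft v w).left = fun u => ω.left (MandelbrotPercolation.graft v u) := rfl

lemma right_graft (v w : List (Fin M)) (ω : LabeledForest M) :
    (ω.graft v w).right = fun u => ω.right (MandelbrotPercolation.graft w u) := rfl

lemma measurable_graft (v w : List (Fin M)) : Measurable (LabeledForest.graft v w) :=
  measurable_pi_lambda _ fun _ => measurable_pi_apply _

lemma map_graft_forestMeasure (p q : unitInterval) (v w : List (Fin M)) :
    (forestMeasure M p q).map (LabeledForest.graft v w) = forestMeasure M p q := by
  have h := Measure.map_infinitePi_infinitePi_of_inj (P := forestNodeMeasure (M := M) p q)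
    (Function.Injective.sumMap (graft_injective v) (graft_injective w))
  unfold forestMeasure
  refine h.trans ?_
  congr 1
  ext1 x
  rcases x with x | x <;> simp [forestNodeMeasure, nodeProb_graft]

/-- The length of a node. -/
def nodeLength : List (Fin M) ⊕ List (Fin M) → ℕ := Sum.elim List.length List.length

/-- Keep the labels up to level `n` of the first forest, and use the second one below. -/
def resample (n : ℕ) (z : LabeledForest M × LabeledForest M) : LabeledForest M :=
  fun x => if nodeLength x ≤ n then z.1 x else z.2 x

lemma resample_of_le {n : ℕ} (z : LabeledForest M × LabeledForest M)
    {x : List (Fin M) ⊕ List (Fin M)} (h : nodeLength x ≤ n) : resample n z x = z.1 x :=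
  if_pos h

lemma resample_of_lt {n : ℕ} (z : LabeledForest M × LabeledForest M)
    {x : List (Fin M) ⊕ List (Fin M)} (h : n < nodeLength x) : resample n z x = z.2 x :=
  if_neg (not_le.2 h)

lemma measurable_resample (n : ℕ) : Measurable (resample (M := M) n) := by
  refine measurable_pi_lambda _ fun x => ?_
  unfold resample
  split_ifs
  · exact (measurable_pi_apply _).comp measurable_fst
  · exact (measurable_pi_apply _).comp measurable_snd

lemma map_resample_forestMeasure (p q : unitInterval) (n : ℕ) :
    ((forestMeasure M p q).prod (forestMeasure M p q)).map (resample n) = forestMeasure M p q :=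
  map_resample_infinitePi (forestNodeMeasure p q) fun x => nodeLength x ≤ n

/-- An event depends on the labels up to level `n` only. -/
def DependsOnLevel (n : ℕ) (A : Set (LabeledForest M)) : Prop :=
  ∀ ω ω' : LabeledForest M, (∀ x, nodeLength x ≤ n → ω x = ω' x) → ω ∈ A → ω' ∈ A

/-- Conditioning on the labels up to level `n`. -/
lemma forestMeasure_inter_eq_lintegral (p q : unitInterval) {n : ℕ} {A E : Set (LabeledForest M)}
    (hA : MeasurableSet A) (hAn : DependsOnLevel n A) (hE : MeasurableSet E) :
    forestMeasure M p q (A ∩ E) =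
      ∫⁻ ω in A, forestMeasure M p q {ω' | resample n (ω, ω') ∈ E} ∂forestMeasure M p q := by
  conv_lhs => rw [← map_resample_forestMeasure p q n]
  rw [Measure.map_apply (measurable_resample n) (hA.inter hE),
    Measure.prod_apply (measurable_resample n (hA.inter hE)), ← lintegral_indicator hA]
  refine lintegral_congr fun ω => ?_
  by_cases hω : ω ∈ A
  · rw [Set.indicator_of_mem hω]
    congr 1
    ext ω'
    simp only [Set.mem_preimage, Set.mem_inter_iff, Set.mem_ofPred_eq, and_iff_right_iff_imp]
    exact fun _ => hAn ω _ (fun x hx => (resample_of_le (ω, ω') hx).symm) hω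
  · rw [Set.indicator_of_notMem hω]
    convert measure_empty (μ := forestMeasure M p q)
    refine Set.eq_empty_of_forall_notMem fun ω' hω' => hω ?_
    exact hAn _ ω (fun x hx => resample_of_le _ hx) hω'.1

lemma measurableSet_mem_survivors (v : List (Fin M)) (n : ℕ) :
    MeasurableSet {X : LabeledTree M | v ∈ survivors X n} := by
  simp only [survivors, Set.mem_ofPred_eq, measurableSet_setOfPred]
  refine Measurable.and measurable_const (.forall fun u => .imp measurable_const <|
    .imp measurable_const ?_)
  exact measurableSet_setOfPred.1 (measurableSet_eq_fun (measurable_pi_apply _) measurable_const)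

lemma measurableSet_mem_survivors_left (v : List (Fin M)) (n : ℕ) :
    MeasurableSet {ω : LabeledForest M | v ∈ survivors ω.left n} :=
  measurable_left (measurableSet_mem_survivors v n)

lemma measurableSet_mem_survivors_right (v : List (Fin M)) (n : ℕ) :
    MeasurableSet {ω : LabeledForest M | v ∈ survivors ω.right n} :=
  measurable_right (measurableSet_mem_survivors v n)

lemma survivors_left_congr {n : ℕ} {ω ω' : LabeledForest M}
    (h : ∀ x, nodeLength x ≤ n → ω x = ω' x) : survivors ω.left n = survivors ω'.left n :=
  survivors_congr fun _ _ hu => h (.inl _) hu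

lemma survivors_right_congr {n : ℕ} {ω ω' : LabeledForest M}
    (h : ∀ x, nodeLength x ≤ n → ω x = ω' x) : survivors ω.right n = survivors ω'.right n :=
  survivors_congr fun _ _ hu => h (.inr _) hu

/-- An event of positive probability that ignores the labels of the roots almost surely occurs for
some pair of surviving subtrees, unless one of the trees is finite. -/
theorem ae_exists_graft_mem (p q : unitInterval) {G : Set (LabeledForest M)}
    (hG : MeasurableSet G) (hG0 : forestMeasure M p q G ≠ 0)
    (hroot : ∀ ω ω' : LabeledForest M, (∀ x, nodeLength x ≠ 0 → ω x = ω' x) → ω ∈ G → ω' ∈ G) :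
    ∀ᵐ ω ∂forestMeasure M p q, (∀ n, (survivors ω.left n).Nonempty) →
      (∀ n, (survivors ω.right n).Nonempty) →
      ∃ n v w, v ∈ survivors ω.left n ∧ w ∈ survivors ω.right n ∧ ω.graft v w ∈ G := by
  set P := forestMeasure M p q
  let T (n : ℕ) : Set (LabeledForest M) :=
    {ω | (∃ v, v ∈ survivors ω.left n) ∧ ∃ w, w ∈ survivors ω.right n}
  let E : Set (LabeledForest M) :=
    {ω | ∃ n v w, v ∈ survivors ω.left n ∧ w ∈ survivors ω.right n ∧ ω.graft v w ∈ G}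
  have hT : ∀ n, MeasurableSet (T n) := fun n =>
    (MeasurableSet.iUnion fun v => measurableSet_mem_survivors_left v n).inter
      (MeasurableSet.iUnion fun v => measurableSet_mem_survivors_right v n)
      |> fun h => by convert h using 1; ext; simp [T]
  have hE : MeasurableSet E := by
    have := MeasurableSet.iUnion fun n => MeasurableSet.iUnion fun v => MeasurableSet.iUnion fun w =>
      (measurableSet_mem_survivors_left v n).inter
        ((measurableSet_mem_survivors_right (M := M) w n).inter (measurable_graft v w hG))
    convert this using 1
    ext; simp [E]
  have key : P ((⋂ n, T n) \ E) = 0 := by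
    refine measure_diff_eq_zero_of_cylinder _ (.iInter hT) hE hG0 (measure_ne_top _ _)
      fun B hB => ?_
    obtain ⟨s, S, hS, rfl⟩ := (mem_measurableCylinders _).1 hB
    -- Deep enough for the cylinder to be determined by the labels up to level `n`. Below any
    -- surviving `v`, `w` of that level, the labels are fresh.
    let n := s.sup nodeLength
    have hBm := MeasurableSet.of_mem_measurableCylinders hB
    have hBn : DependsOnLevel n (cylinder s S ∩ T n) := by
      rintro ω ω' h ⟨h1, h2⟩
      refine ⟨?_, ?_⟩
      · rw [mem_cylinder] at h1 ⊢
        convert h1 using 1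
        ext x
        exact (h x (Finset.le_sup (f := nodeLength) x.2)).symm
      · simpa only [T, Set.mem_ofPred_eq, survivors_left_congr h, survivors_right_congr h] using h2
    calc P G * P (cylinder s S ∩ ⋂ n, T n) ≤ P G * P (cylinder s S ∩ T n) := by
          gcongr; exact Set.iInter_subset _ _
      _ = ∫⁻ ω in cylinder s S ∩ T n, P G ∂P := by simp
      _ ≤ ∫⁻ ω in cylinder s S ∩ T n, P {ω' | resample n (ω, ω') ∈ E} ∂P := by
          refine setLIntegral_mono' (hBm.inter (hT n)) fun ω hω => ?_
          obtain ⟨⟨v, hv⟩, w, hw⟩ := hω.2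
          calc P G = P (LabeledForest.graft v w ⁻¹' G) := by
                rw [← Measure.map_apply (measurable_graft v w) hG, map_graft_forestMeasure]
            _ ≤ _ := measure_mono fun ω' hω' => ?_
          have hagree : ∀ x, nodeLength x ≤ n → ω x = resample n (ω, ω') x :=
            fun x hx => (resample_of_le (ω, ω') hx).symm
          -- The graft of the resampled forest agrees with that of `ω'` except at the roots, whose
          -- labels come from `ω`; `hroot` discards them.
          refine ⟨n, v, w, survivors_left_congr hagree ▸ hv, survivors_right_congr hagree ▸ hw,
            hroot _ _ (fun x hx => ?_) hω'⟩
          refine (resample_of_lt (ω, ω') ?_).symm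
          rcases x with u | u
          all_goals
            have hu : u ≠ [] := fun h => hx (by simp [h, nodeLength])
            have := List.length_pos_iff.2 hu
            simp [nodeLength, graft, hu, hv.1, hw.1, this]
      _ = P (cylinder s S ∩ T n ∩ E) :=
          (forestMeasure_inter_eq_lintegral p q (hBm.inter (hT n)) hBn hE).symm
      _ ≤ P (cylinder s S ∩ E) := measure_mono fun x hx => ⟨hx.1.1, hx.2⟩
  refine measure_mono_null (fun ω hω => ?_) key
  simp only [Set.mem_compl_iff, Set.mem_ofPred_eq, Classical.not_imp] at hω
  exact ⟨Set.mem_iInter.2 fun n => ⟨hω.1 n, hω.2.1 n⟩, hω.2.2⟩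

/-! ### Binomial lower tails -/

/-- Hoeffding's bound for the number of events, out of finitely many independent ones of the same
probability, that occur. -/
lemma measureReal_card_filter_le {Ω ι : Type*} [MeasurableSpace Ω] {P : Measure Ω}
    [IsProbabilityMeasure P] [Fintype ι] {A : ι → Set Ω} (hA : ∀ i, MeasurableSet (A i))
    (hind : iIndepSet A P) {r ε : ℝ} (hr : ∀ i, P.real (A i) = r) (hε : 0 ≤ ε) :
    P.real {ω | ∑ i, (A i).indicator (1 : Ω → ℝ) ω ≤ (r - ε) * Fintype.card ι} ≤
      Real.exp (-(2 * ε ^ 2 * Fintype.card ι)) := by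
  have h1 : iIndepFun (fun i => (A i).indicator (1 : Ω → ℝ)) P := hind.iIndepFun_indicator
  let g : ℝ → ℝ := fun x => -x + r
  have h2 : iIndepFun (fun i ω => g ((A i).indicator (1 : Ω → ℝ) ω)) P :=
    h1.comp (fun _ => g) (fun _ => by fun_prop)
  -- Hoeffding's lemma: a centred variable with values in an interval of length `1` is sub-Gaussian
  -- with parameter `(1/2)² = 1/4`.
  have hsub : ∀ i ∈ (Finset.univ : Finset ι),
      HasSubgaussianMGF (fun ω => g ((A i).indicator (1 : Ω → ℝ) ω)) ((fun _ => 1 / 4) i) P := by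
    intro i _
    have hm : Measurable fun ω => -(A i).indicator (1 : Ω → ℝ) ω :=
      (measurable_one.indicator (hA i)).neg
    have hmem : ∀ ω, -(A i).indicator (1 : Ω → ℝ) ω ∈ Set.Icc (-1 : ℝ) 0 := by
      intro ω
      by_cases h : ω ∈ A i <;> simp [h]
    have := hasSubgaussianMGF_of_mem_Icc (μ := P) hm.aemeasurable (ae_of_all _ hmem)
    convert this using 1
    · ext ω
      rw [integral_neg, integral_indicator_one (hA i), hr i]
      simp [g]
    · ext; norm_num
  have := HasSubgaussianMGF.measure_sum_ge_le_of_iIndepFun h2 hsub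
    (ε := ε * Fintype.card ι) (by positivity)
  refine le_trans (measureReal_mono fun ω hω => ?_) (this.trans (Real.exp_le_exp.2 ?_))
  · simp only [Set.mem_ofPred_eq, g, Finset.sum_add_distrib, Finset.sum_neg_distrib,
      Finset.sum_const, Finset.card_univ, nsmul_eq_mul] at hω ⊢
    linarith
  · simp only [Finset.sum_const, Finset.card_univ, nsmul_eq_mul]
    push_cast
    rcases (Fintype.card ι).eq_zero_or_pos with h0 | h0
    · simp [h0]
    · have : (0 : ℝ) < Fintype.card ι := by exact_mod_cast h0
      apply le_of_eq
      field_simp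
      ring

/-! ### The number of pairs of intervals with a given offset -/

/-- The nodes at level `n`. -/
noncomputable def nodesAt (M n : ℕ) : Finset (List (Fin M)) :=
  (List.finite_length_eq (Fin M) n).toFinset

@[simp] lemma mem_nodesAt {n : ℕ} {v : List (Fin M)} : v ∈ nodesAt M n ↔ v.length = n := by
  simp [nodesAt]

open Classical in
/-- The pairs of surviving intervals of level `n` whose left end points differ by `k / Mⁿ`. -/
noncomputable def offsetPairs (ω : LabeledForest M) (n k : ℕ) :
    Finset (List (Fin M) × List (Fin M)) :=
  (nodesAt M n ×ˢ nodesAt M n).filter fun z =>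
    z.1 ∈ survivors ω.left n ∧ z.2 ∈ survivors ω.right n ∧ index z.2 = index z.1 + k

lemma mem_offsetPairs {ω : LabeledForest M} {n k : ℕ} {z : List (Fin M) × List (Fin M)} :
    z ∈ offsetPairs ω n k ↔
      z.1 ∈ survivors ω.left n ∧ z.2 ∈ survivors ω.right n ∧ index z.2 = index z.1 + k := by
  simp only [offsetPairs, Finset.mem_filter, Finset.mem_product, mem_nodesAt,
    and_iff_right_iff_imp]
  exact fun h => ⟨h.1.1, h.2.1.1⟩

/-- For a fixed offset either node determines the other. Hence distinct pairs have disjoint sets of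
children, the source of independence below. -/
lemma offsetPairs_fst_injOn (ω : LabeledForest M) (n k : ℕ) :
    Set.InjOn Prod.fst (offsetPairs ω n k : Set (List (Fin M) × List (Fin M))) := by
  intro z hz z' hz' h
  have hz := mem_offsetPairs.1 hz
  have hz' := mem_offsetPairs.1 hz'
  refine Prod.ext h (index_injective_of_length_eq (hz.2.1.1.trans hz'.2.1.1.symm) ?_)
  rw [hz.2.2, hz'.2.2, h]

lemma offsetPairs_snd_injOn (ω : LabeledForest M) (n k : ℕ) :
    Set.InjOn Prod.snd (offsetPairs ω n k : Set (List (Fin M) × List (Fin M))) := by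
  intro z hz z' hz' h
  have hz := mem_offsetPairs.1 hz
  have hz' := mem_offsetPairs.1 hz'
  refine Prod.ext (index_injective_of_length_eq (hz.1.1.trans hz'.1.1.symm) ?_) h
  have := hz.2.2
  rw [h, hz'.2.2] at this
  omega

/-- Survival never inspects the root; recording this makes events about these pairs admissible in
`ae_exists_graft_mem`. -/
lemma offsetPairs_congr {ω ω' : LabeledForest M} {n : ℕ}
    (h : ∀ x, nodeLength x ≠ 0 → nodeLength x ≤ n → ω x = ω' x) (k : ℕ) :
    offsetPairs ω n k = offsetPairs ω' n k := by
  have h1 : survivors ω.left n = survivors ω'.left n :=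
    survivors_congr fun u hu hn => h (.inl u) (by simpa [nodeLength] using hu) hn
  have h2 : survivors ω.right n = survivors ω'.right n :=
    survivors_congr fun u hu hn => h (.inr u) (by simpa [nodeLength] using hu) hn
  ext z
  rw [mem_offsetPairs, mem_offsetPairs, h1, h2]

lemma measurable_card_offsetPairs (n k : ℕ) :
    Measurable fun ω : LabeledForest M => (offsetPairs ω n k).card := by
  classical
  simp only [offsetPairs, Finset.card_filter]
  refine Finset.measurable_fun_sum _ fun z _ => Measurable.ite ?_ measurable_const measurable_const
  exact (measurableSet_mem_survivors_left _ _).inter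
    ((measurableSet_mem_survivors_right _ _).inter (MeasurableSet.const _))

/-- The pairs in `offsetPairs ω n k` such that the child `i` of the first and the child `j` of the
second node carry the label `1` in `ω'`. -/
def offsetChildren (ω ω' : LabeledForest M) (n k : ℕ) (i j : Fin M) :
    Set (List (Fin M) × List (Fin M)) :=
  {z ∈ offsetPairs ω n k | ω' (.inl (z.1 ++ [i])) = true ∧ ω' (.inr (z.2 ++ [j])) = true}

lemma offsetChildren_subset (ω ω' : LabeledForest M) (n k : ℕ) (i j : Fin M) :
    offsetChildren ω ω' n k i j ⊆ offsetPairs ω n k := fun _ h => h.1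

/-- Addition with carry: `M a + i + k = M (a + (i + k) / M) + (i + k) % M`. So each last digit `i`
fixes the parents' offset and the other last digit. -/
lemma sum_ncard_offsetChildren_le (hM : 0 < M) (ω : LabeledForest M) (n k : ℕ) :
    ∑ i : Fin M, (offsetChildren ω ω n ((i + k) / M) i ⟨(i + k) % M, Nat.mod_lt _ hM⟩).ncard ≤
      (offsetPairs ω (n + 1) k).card := by
  classical
  have hfin : ∀ k i j, (offsetChildren ω ω n k i j).Finite := fun k i j =>
    (Finset.finite_toSet _).subset (offsetChildren_subset ω ω n k i j)
  simp_rw [Set.ncard_eq_toFinset_card _ (hfin _ _ _)]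
  rw [← Finset.card_sigma]
  refine Finset.card_le_card_of_injOn
    (fun x => (x.2.1 ++ [x.1], x.2.2 ++ [⟨(x.1 + k) % M, Nat.mod_lt _ hM⟩])) ?_ ?_
  · rintro ⟨i, z⟩ hz
    simp only [Finset.coe_sigma, Set.mem_sigma_iff, Finset.mem_coe, Set.Finite.mem_toFinset] at hz
    obtain ⟨hz, hi, hj⟩ := hz.2
    have hz := mem_offsetPairs.1 hz
    refine mem_offsetPairs.2 ⟨mem_survivors_concat.2 ⟨hz.1, hi⟩,
      mem_survivors_concat.2 ⟨hz.2.1, hj⟩, ?_⟩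
    simp only [index_concat, hz.2.2]
    have := Nat.div_add_mod (i + k) M
    rw [mul_add]
    omega
  · rintro ⟨i, z⟩ hz ⟨i', z'⟩ hz' h
    simp only [Prod.mk.injEq] at h
    obtain ⟨h1, h2⟩ := h
    have h1 := List.append_inj' h1 rfl
    have h2 := List.append_inj' h2 rfl
    have : i = i' := by simpa using h1.2
    subst this
    rw [Sigma.mk.injEq]
    exact ⟨rfl, heq_of_eq (Prod.ext h1.1 h2.1)⟩

/-! ### Probabilities of labels -/

lemma bernoulliMeasure_nodeProb_true (p : unitInterval) {v : List (Fin M)} (hv : v ≠ []) :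
    bernoulliMeasure true false (nodeProb (fun _ : Fin M => p) v) {true} = ENNReal.ofReal p := by
  obtain ⟨v, i, rfl⟩ := v.eq_nil_or_concat'.resolve_left hv
  simp [nodeProb, ENNReal.ofReal, Real.toNNReal_of_nonneg p.2.1]
  rfl

lemma forestMeasure_forall_eq_true (p q : unitInterval) (s t : Finset (List (Fin M)))
    (hs : [] ∉ s) (ht : [] ∉ t) :
    forestMeasure M p q {ω | (∀ v ∈ s, ω.left v = true) ∧ ∀ w ∈ t, ω.right w = true} =
      ENNReal.ofReal p ^ s.card * ENNReal.ofReal q ^ t.card := by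
  have : {ω : LabeledForest M | (∀ v ∈ s, ω.left v = true) ∧ ∀ w ∈ t, ω.right w = true} =
      Set.pi (s.disjSum t : Finset _) fun _ => {true} := by
    ext ω
    simp [Set.mem_pi, Sum.forall]
  rw [this, forestMeasure, Measure.infinitePi_pi _ fun _ _ => measurableSet_singleton _,
    Finset.prod_disjSum]
  congr 1
  · refine Finset.prod_eq_pow_card fun v hv => bernoulliMeasure_nodeProb_true p ?_
    rintro rfl; exact hs hv
  · refine Finset.prod_eq_pow_card fun v hv => bernoulliMeasure_nodeProb_true q ?_
    rintro rfl; exact ht hv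

/-- With the pairs of `ω` frozen, their children in `ω'` are distinct nodes, so the events are
independent of probability `p q` and Hoeffding's bound applies. -/
lemma measureReal_ncard_offsetChildren_le (p q : unitInterval) (ω : LabeledForest M) (n k : ℕ)
    (i j : Fin M) {ε : ℝ} (hε : 0 ≤ ε) :
    (forestMeasure M p q).real {ω' | ((offsetChildren ω ω' n k i j).ncard : ℝ) ≤
      (p * q - ε) * (offsetPairs ω n k).card} ≤
        Real.exp (-(2 * ε ^ 2 * (offsetPairs ω n k).card)) := by
  classical
  set s := offsetPairs ω n k
  let A : s → Set (LabeledForest M) := fun z =>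
    {ω' | ω' (.inl (z.1.1 ++ [i])) = true ∧ ω' (.inr (z.1.2 ++ [j])) = true}
  have hA : ∀ z, MeasurableSet (A z) := fun z =>
    (measurableSet_eq_fun (measurable_pi_apply _) measurable_const).inter
      (measurableSet_eq_fun (measurable_pi_apply _) measurable_const)
  have hprob : ∀ t : Finset s, forestMeasure M p q (⋂ z ∈ t, A z) =
      (ENNReal.ofReal p * ENNReal.ofReal q) ^ t.card := by
    intro t
    have h1 : (t.image fun z => z.1.1 ++ [i]).card = t.card :=
      Finset.card_image_of_injective _ fun z z' h => Subtype.ext <|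
        offsetPairs_fst_injOn ω n k z.2 z'.2 (List.append_inj' h rfl).1
    have h2 : (t.image fun z => z.1.2 ++ [j]).card = t.card :=
      Finset.card_image_of_injective _ fun z z' h => Subtype.ext <|
        offsetPairs_snd_injOn ω n k z.2 z'.2 (List.append_inj' h rfl).1
    have := forestMeasure_forall_eq_true p q (t.image fun z => z.1.1 ++ [i])
      (t.image fun z => z.1.2 ++ [j]) (by simp) (by simp)
    rw [h1, h2, ← mul_pow] at this
    rw [← this]
    congr 1
    ext ω'
    simp only [Set.mem_iInter, A, Set.mem_ofPred_eq, Finset.forall_mem_image]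
    exact ⟨fun h => ⟨fun z hz => (h z hz).1, fun z hz => (h z hz).2⟩,
      fun h z hz => ⟨h.1 hz, h.2 hz⟩⟩
  have hprob1 : ∀ z, forestMeasure M p q (A z) = ENNReal.ofReal p * ENNReal.ofReal q := by
    intro z
    simpa using hprob {z}
  have hind : iIndepSet A (forestMeasure M p q) := by
    rw [iIndepSet_iff_meas_biInter hA]
    intro t
    rw [hprob, Finset.prod_congr rfl fun z _ => hprob1 z, Finset.prod_const]
  have := measureReal_card_filter_le hA hind (r := p * q) (ε := ε) (fun z => by
    rw [measureReal_def, hprob1, ENNReal.toReal_mul, ENNReal.toReal_ofReal p.2.1,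
      ENNReal.toReal_ofReal q.2.1]) hε
  rw [Fintype.card_coe] at this
  refine le_trans (le_of_eq ?_) this
  congr 1
  ext ω'
  have hcard : ((offsetChildren ω ω' n k i j).ncard : ℝ) =
      ∑ z, (A z).indicator (1 : LabeledForest M → ℝ) ω' := by
    have h1 : offsetChildren ω ω' n k i j = (s.filter fun z =>
        ω' (.inl (z.1 ++ [i])) = true ∧ ω' (.inr (z.2 ++ [j])) = true : Finset _) := by
      ext z; simp [offsetChildren, s]
    rw [h1, Set.ncard_coe_finset, Finset.card_filter]
    push_cast
    rw [← Finset.sum_coe_sort s]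
    refine Finset.sum_congr rfl fun z _ => ?_
    simp [A, Set.indicator_apply]
  simp only [Set.mem_ofPred_eq, hcard]

/-! ### Growth of the number of pairs with a given offset -/

/-- If all offsets up to `K` have at least `N` pairs at level `n`, then all offsets up to `M K` have
at least `M (p q - ε) N` pairs at level `n + 1` with overwhelming conditional probability. -/
lemma measure_resample_few_offsetPairs_le (hM : 0 < M) (p q : unitInterval) {ε N : ℝ}
    (hε : 0 < ε) (hpq : 0 < p * q - ε) {n K : ℕ} {ω : LabeledForest M}
    (hω : ∀ k ≤ K, N ≤ (offsetPairs ω n k).card) :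
    forestMeasure M p q {ω' | ¬ ∀ k ≤ M * K,
      (M : ℝ) * ((p : ℝ) * q - ε) * N ≤ (offsetPairs (resample n (ω, ω')) (n + 1) k).card} ≤
      ENNReal.ofReal ((K + 1) * M ^ 2 * Real.exp (-(2 * ε ^ 2 * N))) := by
  set P := forestMeasure M p q
  let B : ℕ → Fin M → Fin M → Set (LabeledForest M) := fun k i j =>
    {ω' | ((offsetChildren ω ω' n k i j).ncard : ℝ) ≤ (p * q - ε) * (offsetPairs ω n k).card}
  have hB : ∀ k ≤ K, ∀ i j, P (B k i j) ≤ ENNReal.ofReal (Real.exp (-(2 * ε ^ 2 * N))) := by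
    intro k hk i j
    rw [← ENNReal.ofReal_toReal (measure_ne_top P (B k i j))]
    refine ENNReal.ofReal_le_ofReal
      ((measureReal_ncard_offsetChildren_le p q ω n k i j hε.le).trans ?_)
    have := hω k hk
    gcongr
  have hsub : {ω' | ¬ ∀ k ≤ M * K,
      (M : ℝ) * ((p : ℝ) * q - ε) * N ≤ (offsetPairs (resample n (ω, ω')) (n + 1) k).card} ⊆
      ⋃ k ∈ Finset.range (K + 1), ⋃ i, ⋃ j, B k i j := by
    intro ω' hω'
    by_contra hcon
    refine hω' ?_
    simp only [Set.mem_iUnion, not_exists, Finset.mem_range, Nat.lt_succ_iff, B, Set.mem_ofPred_eq,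
      not_le] at hcon
    intro k hk
    set ζ := resample n (ω, ω')
    have hζ : ∀ l, offsetPairs ζ n l = offsetPairs ω n l := fun l =>
      offsetPairs_congr (fun x _ hx => resample_of_le (ω, ω') hx) l
    have hζ' : ∀ l i j, offsetChildren ζ ζ n l i j = offsetChildren ω ω' n l i j := by
      intro l i j
      ext z
      simp only [offsetChildren, Set.mem_ofPred_eq, hζ]
      refine and_congr_right fun hz => ?_
      have hz := mem_offsetPairs.1 hz
      have h1 : ζ (.inl (z.1 ++ [i])) = ω' (.inl (z.1 ++ [i])) :=
        resample_of_lt (ω, ω') (by simp [nodeLength, hz.1.1])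
      have h2 : ζ (.inr (z.2 ++ [j])) = ω' (.inr (z.2 ++ [j])) :=
        resample_of_lt (ω, ω') (by simp [nodeLength, hz.2.1.1])
      rw [h1, h2]
    have hsum := sum_ncard_offsetChildren_le hM ζ n k
    calc (M : ℝ) * ((p : ℝ) * q - ε) * N = ∑ _i : Fin M, ((p : ℝ) * q - ε) * N := by
          simp [mul_assoc]
      _ ≤ ∑ i : Fin M, ((offsetChildren ζ ζ n ((i + k) / M) i
            ⟨(i + k) % M, Nat.mod_lt _ hM⟩).ncard : ℝ) := by
          refine Finset.sum_le_sum fun i _ => ?_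
          -- As `i + k < M (K + 1)`, offsets up to `M K` only need parents with offsets up to `K`:
          -- the real range `K / Mⁿ` does not shrink.
          have hiK : (i + k) / M ≤ K := by
            rw [← Nat.lt_succ_iff]
            refine Nat.div_lt_of_lt_mul ?_
            have := i.2
            rw [Nat.succ_eq_add_one, mul_add]
            omega
          rw [hζ']
          refine le_trans ?_ (hcon _ hiK _ _).le
          have := hω _ hiK
          gcongr
      _ ≤ _ := by exact_mod_cast hsum
  calc _ ≤ ∑ k ∈ Finset.range (K + 1), ∑ i : Fin M, ∑ j : Fin M, P (B k i j) := by
        refine (measure_mono hsub).trans ((measure_biUnion_finset_le _ _).trans ?_)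
        refine Finset.sum_le_sum fun k _ => ?_
        refine (measure_iUnion_fintype_le _ _).trans (Finset.sum_le_sum fun i _ => ?_)
        exact measure_iUnion_fintype_le _ _
    _ ≤ ∑ k ∈ Finset.range (K + 1), ∑ i : Fin M, ∑ j : Fin M,
          ENNReal.ofReal (Real.exp (-(2 * ε ^ 2 * N))) := by
        refine Finset.sum_le_sum fun k hk => Finset.sum_le_sum fun i _ =>
          Finset.sum_le_sum fun j _ => hB k ?_ i j
        exact Nat.lt_succ_iff.1 (Finset.mem_range.1 hk)
    _ = _ := by
        rw [ENNReal.ofReal_mul (by positivity)]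
        simp only [Finset.sum_const, Finset.card_range, Finset.card_univ, Fintype.card_fin,
          nsmul_eq_mul]
        have : ENNReal.ofReal (((K : ℝ) + 1) * (M : ℝ) ^ 2) = ((K + 1 : ℕ) : ℝ≥0∞) * (M * M) := by
          rw [← ENNReal.ofReal_natCast, ← ENNReal.ofReal_natCast, ← ENNReal.ofReal_mul (by positivity),
            ← ENNReal.ofReal_mul (by positivity)]
          push_cast
          ring_nf
        simp only [this, mul_assoc]

lemma card_offsetPairs_of_forall_eq_true {ω : LabeledForest M} {n k : ℕ} (hk : k ≤ 1)
    (h : ∀ x, nodeLength x ≠ 0 → nodeLength x ≤ n → ω x = true) :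
    M ^ n - 1 ≤ (offsetPairs ω n k).card := by
  classical
  have hsurv : ∀ v : List (Fin M), v.length = n →
      v ∈ survivors ω.left n ∧ v ∈ survivors ω.right n := fun v hv =>
    ⟨⟨hv, fun u hu huv => h (.inl u) (by simpa [nodeLength] using hu) (hv ▸ huv.length_le)⟩,
      ⟨hv, fun u hu huv => h (.inr u) (by simpa [nodeLength] using hu) (hv ▸ huv.length_le)⟩⟩
  calc M ^ n - 1 = (Finset.range (M ^ n - 1)).card := by simp
    _ ≤ ((offsetPairs ω n k).image fun z => index z.1).card := by
        refine Finset.card_le_card fun a ha => ?_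
        rw [Finset.mem_range] at ha
        obtain ⟨v, hv, hva⟩ := exists_index_eq (M := M) n a (by omega)
        obtain ⟨w, hw, hwa⟩ := exists_index_eq (M := M) n (a + k) (by omega)
        exact Finset.mem_image.2 ⟨(v, w), mem_offsetPairs.2 ⟨(hsurv v hv).1, (hsurv w hw).2,
          by simp [hva, hwa]⟩, hva⟩
    _ ≤ _ := Finset.card_image_le

lemma forestMeasure_forall_eq_true_ne_zero {p q : unitInterval} (hp : 0 < (p : ℝ))
    (hq : 0 < (q : ℝ)) (n : ℕ) :
    forestMeasure M p q {ω | ∀ x, nodeLength x ≠ 0 → nodeLength x ≤ n → ω x = true} ≠ 0 := by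
  classical
  let s : Finset (List (Fin M)) := (List.finite_length_le (Fin M) n).toFinset.erase []
  have hs : ∀ v, v ∈ s ↔ v ≠ [] ∧ v.length ≤ n := by simp [s]
  have := forestMeasure_forall_eq_true p q s s (by simp [s]) (by simp [s])
  have heq : {ω : LabeledForest M | ∀ x, nodeLength x ≠ 0 → nodeLength x ≤ n → ω x = true} =
      {ω | (∀ v ∈ s, ω.left v = true) ∧ ∀ w ∈ s, ω.right w = true} := by
    ext ω
    simp [Sum.forall, nodeLength, hs]
  rw [heq, this]
  simp [hp, hq]

/-- The left side is the union bound for the failure at step `m`. The right sides sum to `1/2`,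
which leaves half of the starting event. -/
lemma exists_large_start {c θ : ℝ} (hc : 0 < c) (hθ : 1 < θ) (hM : 0 < M) :
    ∃ N : ℝ, 0 < N ∧ ∀ m : ℕ, ((M : ℝ) ^ m + 1) * (M : ℝ) ^ 2 * Real.exp (-(c * (θ ^ m * N))) ≤
      (1 / 2) ^ (m + 2) := by
  have hM1 : (1 : ℝ) ≤ M := by exact_mod_cast hM
  have hM0 : (0 : ℝ) < M := by linarith
  -- The first bound settles `m = 0`; the second gains a factor `2 M` per step through Bernoulli's
  -- inequality `θᵐ ≥ 1 + m (θ - 1)`.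
  obtain ⟨N, hN⟩ := exists_gt (max (max (Real.log (8 * (M : ℝ) ^ 2) / c)
    (Real.log (2 * M) / (c * (θ - 1)))) 0)
  simp only [max_lt_iff] at hN
  obtain ⟨⟨h1, h2⟩, h0⟩ := hN
  have hθ1 : 0 < θ - 1 := by linarith
  rw [div_lt_iff₀ hc] at h1
  rw [div_lt_iff₀ (by positivity)] at h2
  refine ⟨N, h0, fun m => ?_⟩
  have hbern : 1 + m * (θ - 1) ≤ θ ^ m := by
    have := one_add_mul_le_pow (a := θ - 1) (by linarith) m
    simpa using this
  have hexp : Real.log (8 * (M : ℝ) ^ 2) + m * Real.log (2 * M) ≤ c * (θ ^ m * N) := by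
    calc Real.log (8 * (M : ℝ) ^ 2) + m * Real.log (2 * M)
        ≤ N * c + m * (N * (c * (θ - 1))) := by gcongr
      _ = c * ((1 + m * (θ - 1)) * N) := by ring
      _ ≤ _ := by gcongr
  have hE : Real.exp (-(c * (θ ^ m * N))) ≤ (8 * (M : ℝ) ^ 2 * (2 * M) ^ m)⁻¹ := by
    rw [Real.exp_neg]
    apply inv_anti₀ (by positivity)
    calc 8 * (M : ℝ) ^ 2 * (2 * M) ^ m
        = Real.exp (Real.log (8 * (M : ℝ) ^ 2) + m * Real.log (2 * M)) := by
          rw [Real.exp_add, Real.exp_log (by positivity), Real.exp_nat_mul,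
            Real.exp_log (by positivity)]
      _ ≤ _ := Real.exp_le_exp.2 hexp
  have hMm : (M : ℝ) ^ m + 1 ≤ 2 * (M : ℝ) ^ m := by
    have := one_le_pow₀ (n := m) hM1
    linarith
  calc ((M : ℝ) ^ m + 1) * (M : ℝ) ^ 2 * Real.exp (-(c * (θ ^ m * N)))
      ≤ 2 * (M : ℝ) ^ m * (M : ℝ) ^ 2 * (8 * (M : ℝ) ^ 2 * (2 * M) ^ m)⁻¹ := by gcongr
    _ = (1 / 2) ^ (m + 2) := by
      rw [mul_pow, one_div, inv_pow, pow_add]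
      field_simp
      norm_num

/-- The forests that have at least `θˡ N` pairs with offset `k` at level `n₀ + l`, for `k ≤ Mˡ` and
`l ≤ m`. -/
def richForests (M n₀ : ℕ) (θ N : ℝ) (m : ℕ) : Set (LabeledForest M) :=
  {ω | ∀ l ≤ m, ∀ k ≤ M ^ l, θ ^ l * N ≤ (offsetPairs ω (n₀ + l) k).card}

lemma measurableSet_richForests (n₀ : ℕ) (θ N : ℝ) (m : ℕ) :
    MeasurableSet (richForests M n₀ θ N m) := by
  unfold richForests
  simp only [Set.ofPred_forall]
  refine .iInter fun l => .iInter fun _ => .iInter fun k => .iInter fun _ => ?_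
  exact measurableSet_le measurable_const
    (measurable_from_top.comp (measurable_card_offsetPairs _ _))

lemma richForests_antitone (n₀ : ℕ) (θ N : ℝ) : Antitone (richForests M n₀ θ N) :=
  fun _ _ hm _ hω l hl => hω l (hl.trans hm)

lemma richForests_congr {n₀ : ℕ} {θ N : ℝ} {m : ℕ} {ω ω' : LabeledForest M}
    (h : ∀ x, nodeLength x ≠ 0 → nodeLength x ≤ n₀ + m → ω x = ω' x)
    (hω : ω ∈ richForests M n₀ θ N m) : ω' ∈ richForests M n₀ θ N m := by
  intro l hl k hk
  rw [← offsetPairs_congr (ω := ω) fun x hx hx' => h x hx (by omega)]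
  exact hω l hl k hk

/-- A full tree down to level `n₀` has positive probability and starts with many pairs. From then on
step `m` loses at most `2⁻⁽ᵐ⁺²⁾` of the initial event, in total at most half of it. -/
theorem exists_forestMeasure_iInter_richForests_ne_zero (hM : 2 ≤ M) {p q : unitInterval}
    (hpq : 1 < (M : ℝ) * (p * q)) :
    ∃ (n₀ : ℕ) (θ N : ℝ), 0 < θ ∧ 0 < N ∧
      forestMeasure M p q (⋂ m, richForests M n₀ θ N m) ≠ 0 := by
  have hM0 : 0 < M := by omega
  have hMR : (0 : ℝ) < M := by exact_mod_cast hM0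
  have hr : 0 < (p : ℝ) * q := by
    by_contra! h
    nlinarith
  have hp : 0 < (p : ℝ) := pos_of_mul_pos_left hr q.2.1
  have hq : 0 < (q : ℝ) := pos_of_mul_pos_right hr p.2.1
  -- Splits the slack in `M p q > 1`: `θ = M r > 1` is the growth rate, `ε = p q - r > 0` the
  -- deviation allowed in Hoeffding's bound.
  obtain ⟨r, hr1, hr2⟩ := exists_between (show 1 / (M : ℝ) < p * q by
    rwa [div_lt_iff₀ hMR, mul_comm])
  have hr0 : 0 < r := lt_trans (by positivity) hr1
  let ε := (p : ℝ) * q - r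
  have hε : 0 < ε := sub_pos.2 hr2
  have hεr : (p : ℝ) * q - ε = r := by simp [ε]
  let θ := (M : ℝ) * r
  have hθ : 1 < θ := by rwa [div_lt_iff₀ hMR, mul_comm] at hr1
  obtain ⟨N, hN, hNm⟩ := exists_large_start (M := M) (c := 2 * ε ^ 2) (by positivity) hθ hM0
  obtain ⟨n₀, hn₀⟩ := pow_unbounded_of_one_lt (N + 1) (show (1 : ℝ) < M by exact_mod_cast hM)
  refine ⟨n₀, θ, N, by linarith, hN, fun hzero => ?_⟩
  set P := forestMeasure M p q
  set H := richForests M n₀ θ N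
  have hH0 : P (H 0) ≠ 0 := by
    refine fun h => forestMeasure_forall_eq_true_ne_zero (M := M) hp hq n₀
      (measure_mono_null (fun ω hω => ?_) h)
    intro l hl k hk
    obtain rfl : l = 0 := by omega
    have h1 := card_offsetPairs_of_forall_eq_true (k := k) (by simpa using hk) hω
    have h2 : ((M ^ n₀ - 1 : ℕ) : ℝ) ≤ (offsetPairs ω n₀ k).card := by exact_mod_cast h1
    rw [Nat.cast_sub (Nat.one_le_pow _ _ hM0)] at h2
    push_cast at h2
    simp only [pow_zero, one_mul, add_zero]
    linarith
  have hstep : ∀ m, P (H m \ H (m + 1)) ≤ P (H 0) * 2⁻¹ ^ (m + 2) := by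
    intro m
    have hdep : DependsOnLevel (n₀ + m) (H m) := fun ω ω' h hω =>
      richForests_congr (fun x _ hx => h x hx) hω
    rw [Set.sdiff_eq, forestMeasure_inter_eq_lintegral p q (measurableSet_richForests _ _ _ _) hdep
      (measurableSet_richForests _ _ _ _).compl]
    calc ∫⁻ ω in H m, P {ω' | resample (n₀ + m) (ω, ω') ∈ (H (m + 1))ᶜ} ∂P
        ≤ ∫⁻ ω in H m, 2⁻¹ ^ (m + 2) ∂P := by
          refine setLIntegral_mono' (measurableSet_richForests _ _ _ _) fun ω hω => ?_
          have h := measure_resample_few_offsetPairs_le hM0 p q (n := n₀ + m) (K := M ^ m) hε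
            (N := θ ^ m * N) (by rwa [hεr]) (hω m le_rfl)
          calc _ ≤ _ := measure_mono fun ω' hω' => ?_
            _ ≤ _ := h
            _ ≤ _ := by
              have : (2⁻¹ : ℝ≥0∞) ^ (m + 2) = ENNReal.ofReal ((1 / 2) ^ (m + 2)) := by
                rw [ENNReal.ofReal_pow (by positivity), one_div,
                  ENNReal.ofReal_inv_of_pos (by positivity)]
                simp
              rw [this]
              refine ENNReal.ofReal_le_ofReal ?_
              exact_mod_cast hNm m
          intro hgood
          refine hω' fun l hl k hk => ?_
          rcases Nat.lt_or_ge l (m + 1) with hlm | hlm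
          · exact hdep ω _ (fun x hx => (resample_of_le (ω, ω') hx).symm) hω l (by omega) k hk
          · obtain rfl : l = m + 1 := by omega
            have := hgood k (by rwa [pow_succ'] at hk)
            rw [hεr] at this
            rw [pow_succ', mul_assoc]
            exact this
      _ = 2⁻¹ ^ (m + 2) * P (H m) := by simp
      _ ≤ P (H 0) * 2⁻¹ ^ (m + 2) := by
          rw [mul_comm]
          gcongr
          exact richForests_antitone _ _ _ m.zero_le
  have hcover : H 0 ⊆ (⋂ m, H m) ∪ ⋃ m, H m \ H (m + 1) := by
    intro ω hω
    by_contra hcon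
    simp only [Set.mem_union, Set.mem_iInter, Set.mem_iUnion, Set.mem_sdiff, not_or, not_exists,
      not_and, not_not] at hcon
    exact hcon.1 fun m => Nat.rec hω (fun m ih => hcon.2 m ih) m
  have hsum : ∑' m : ℕ, P (H 0) * (2⁻¹ : ℝ≥0∞) ^ (m + 2) = P (H 0) / 2 := by
    rw [ENNReal.tsum_mul_left]
    simp only [pow_add, ENNReal.tsum_mul_right, ENNReal.tsum_geometric, ENNReal.one_sub_inv_two,
      inv_inv, ENNReal.div_eq_inv_mul]
    rw [mul_comm, pow_two, ← mul_assoc 2, ENNReal.mul_inv_cancel (by simp) (by simp), one_mul]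
  have hle : P (H 0) ≤ P (H 0) / 2 :=
    calc P (H 0) ≤ P (⋂ m, H m) + P (⋃ m, H m \ H (m + 1)) :=
          (measure_mono hcover).trans (measure_union_le _ _)
      _ ≤ 0 + ∑' m, P (H m \ H (m + 1)) := by
          gcongr
          · exact hzero.le
          · exact measure_iUnion_le _
      _ ≤ ∑' m : ℕ, P (H 0) * (2⁻¹ : ℝ≥0∞) ^ (m + 2) := by
          rw [zero_add]
          exact ENNReal.tsum_le_tsum hstep
      _ = P (H 0) / 2 := hsum
  exact absurd hle (not_le.2 (ENNReal.half_lt_self hH0 (measure_ne_top _ _)))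

/-- Approximate `t` by offsets `⌊t Mⁿ⌋ / Mⁿ`, `n = n₀ + m`; the bound `t ≤ M^(-n₀)` keeps them in
the rich range `k ≤ Mᵐ`. Limits of left end points along a subsequence lie in the closed nested
level sets and differ by `t`. -/
lemma Icc_subset_randomCantorSet_sub (hM : 2 ≤ M) {n₀ : ℕ} {θ N : ℝ} (hθ : 0 < θ) (hN : 0 < N)
    {ω : LabeledForest M} (hω : ω ∈ ⋂ m, richForests M n₀ θ N m) :
    Set.Icc 0 (1 / (M : ℝ) ^ n₀) ⊆ randomCantorSet ω.right - randomCantorSet ω.left := by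
  intro t ht
  have hM1 : (1 : ℝ) < M := by exact_mod_cast hM
  have hMR : (0 : ℝ) < M := by linarith
  replace hM : 0 < M := by omega
  have hex : ∀ m : ℕ, ∃ z, z ∈ offsetPairs ω (n₀ + m) ⌊t * (M : ℝ) ^ (n₀ + m)⌋₊ := by
    intro m
    have hk : ⌊t * (M : ℝ) ^ (n₀ + m)⌋₊ ≤ M ^ m := by
      refine Nat.floor_le_of_le ?_
      calc t * (M : ℝ) ^ (n₀ + m) ≤ 1 / (M : ℝ) ^ n₀ * (M : ℝ) ^ (n₀ + m) := by
            gcongr; exact ht.2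
        _ = ((M ^ m : ℕ) : ℝ) := by
            rw [pow_add]; push_cast; field_simp
    have h := Set.mem_iInter.1 hω m m le_rfl _ hk
    have hpos : (0 : ℝ) < (offsetPairs ω (n₀ + m) ⌊t * (M : ℝ) ^ (n₀ + m)⌋₊).card :=
      lt_of_lt_of_le (by positivity) h
    exact Finset.card_pos.1 (by exact_mod_cast hpos)
  choose z hz using hex
  have hz := fun m => mem_offsetPairs.1 (hz m)
  obtain ⟨a, -, φ, hφ, ha⟩ := (isCompact_Icc (a := (0 : ℝ)) (b := 1)).tendsto_subseq
    (x := fun m => leftEnd (z m).1)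
    fun m => levelSet_subset_Icc hM _ _ (leftEnd_mem_levelSet (hz m).1)
  have hdiff : ∀ m, leftEnd (z m).2 =
      leftEnd (z m).1 + (⌊t * (M : ℝ) ^ (n₀ + m)⌋₊ : ℝ) / (M : ℝ) ^ (n₀ + m) := by
    intro m
    rw [leftEnd_eq_index_div hM, leftEnd_eq_index_div hM, (hz m).1.1, (hz m).2.1.1, (hz m).2.2]
    push_cast
    rw [add_div]
  have hlim : Filter.Tendsto (fun m => (⌊t * (M : ℝ) ^ (n₀ + m)⌋₊ : ℝ) / (M : ℝ) ^ (n₀ + m))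
      Filter.atTop (nhds t) := by
    have hpow : Filter.Tendsto (fun m => (M : ℝ) ^ (n₀ + m)) Filter.atTop Filter.atTop :=
      (tendsto_pow_atTop_atTop_of_one_lt hM1).comp
        (Filter.tendsto_atTop_mono (fun m => Nat.le_add_left m n₀) Filter.tendsto_id)
    exact (tendsto_nat_floor_mul_div_atTop ht.1).comp hpow
  have hb : Filter.Tendsto (fun m => leftEnd (z (φ m)).2) Filter.atTop (nhds (a + t)) := by
    simp only [hdiff]
    exact ha.add (hlim.comp hφ.tendsto_atTop)
  have hmem : ∀ {X : LabeledTree M} {x : ℝ} {v : ℕ → List (Fin M)},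
      (∀ m, v m ∈ survivors X (n₀ + m)) →
      Filter.Tendsto (fun m => leftEnd (v (φ m))) Filter.atTop (nhds x) →
      x ∈ randomCantorSet X := by
    intro X x v hv hx
    refine mem_randomCantorSet_of_frequently hM fun n => ⟨n, le_rfl, ?_⟩
    refine (isClosed_levelSet X n).mem_of_tendsto hx ?_
    filter_upwards [Filter.eventually_ge_atTop n] with m hm
    exact levelSet_antitone hM X (by have := hφ.le_apply (x := m); omega)
      (leftEnd_mem_levelSet (hv (φ m)))
  exact ⟨a + t, hmem (fun m => (hz m).2.1) hb, a, hmem (fun m => (hz m).1) ha, by simp⟩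

/-! ### First moments -/

instance (p : unitInterval) : IsProbabilityMeasure (treeMeasure fun _ : Fin M => p) := by
  unfold treeMeasure; infer_instance

lemma treeMeasure_mem_survivors (p : unitInterval) {n : ℕ} {v : List (Fin M)}
    (hv : v.length = n) :
    (treeMeasure fun _ : Fin M => p) {X | v ∈ survivors X n} = ENNReal.ofReal p ^ n := by
  classical
  let s : Finset (List (Fin M)) := (Finset.range n).image fun k => v.take (k + 1)
  have hs : s.card = n := by
    rw [Finset.card_image_of_injOn, Finset.card_range]
    intro a ha b hb hab
    simp only [Finset.coe_range, Set.mem_Iio] at ha hb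
    have := congrArg List.length hab
    simp only [List.length_take] at this
    omega
  have hmem : ∀ u, u ∈ s ↔ u ≠ [] ∧ u <+: v := by
    intro u
    simp only [s, Finset.mem_image, Finset.mem_range]
    constructor
    · rintro ⟨k, hk, rfl⟩
      refine ⟨?_, List.take_prefix _ _⟩
      rw [← List.length_pos_iff, List.length_take]
      omega
    · rintro ⟨hu, huv⟩
      have h1 := List.length_pos_iff.2 hu
      have h2 := huv.length_le
      refine ⟨u.length - 1, by omega, ?_⟩
      rw [Nat.sub_add_cancel h1]
      exact (List.prefix_iff_eq_take.1 huv).symm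
  have heq : {X : LabeledTree M | v ∈ survivors X n} = Set.pi s fun _ => {true} := by
    ext X
    simp [survivors, Set.mem_pi, hmem, hv]
  rw [heq, treeMeasure, Measure.infinitePi_pi _ fun _ _ => measurableSet_singleton _,
    Finset.prod_eq_pow_card (fun u hu => bernoulliMeasure_nodeProb_true p ((hmem u).1 hu).1), hs]

lemma card_nodesAt_le (n : ℕ) : (nodesAt M n).card ≤ M ^ n := by
  rw [← Finset.card_range (M ^ n)]
  refine Finset.card_le_card_of_injOn index (fun v hv => ?_) fun v hv w hw h => ?_
  · have hv : v.length = n := by simpa using hv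
    simpa [hv] using index_lt v
  · have hv : v.length = n := by simpa using hv
    have hw : w.length = n := by simpa using hw
    exact index_injective_of_length_eq (hv.trans hw.symm) h

lemma ncard_survivors_eq_sum (X : LabeledTree M) (n : ℕ) :
    ((survivors X n).ncard : ℝ≥0∞) =
      ∑ v ∈ nodesAt M n, {X : LabeledTree M | v ∈ survivors X n}.indicator 1 X := by
  classical
  have : survivors X n = ((nodesAt M n).filter (· ∈ survivors X n) : Finset _) := by
    ext v
    simp only [Finset.coe_filter, mem_nodesAt, Set.mem_ofPred_eq]
    exact ⟨fun h => ⟨h.1, h⟩, fun h => h.2⟩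
  conv_lhs => rw [this, Set.ncard_coe_finset, Finset.card_filter]
  push_cast
  refine Finset.sum_congr rfl fun v _ => ?_
  simp [Set.indicator_apply]

lemma measurable_ncard_survivors (n : ℕ) :
    Measurable fun X : LabeledTree M => ((survivors X n).ncard : ℝ≥0∞) := by
  simp only [ncard_survivors_eq_sum]
  exact Finset.measurable_fun_sum _ fun v _ =>
    measurable_one.indicator (measurableSet_mem_survivors v n)

lemma lintegral_ncard_survivors_le (p : unitInterval) (n : ℕ) :
    ∫⁻ X, ((survivors X n).ncard : ℝ≥0∞) ∂(treeMeasure fun _ : Fin M => p) ≤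
      (M * ENNReal.ofReal p) ^ n := by
  simp only [ncard_survivors_eq_sum]
  rw [lintegral_finsetSum _ fun v _ =>
    measurable_one.indicator (measurableSet_mem_survivors v n)]
  calc _ = ∑ v ∈ nodesAt M n, ENNReal.ofReal p ^ n := by
        refine Finset.sum_congr rfl fun v hv => ?_
        rw [lintegral_indicator_one (measurableSet_mem_survivors v n),
          treeMeasure_mem_survivors p (mem_nodesAt.1 hv)]
    _ ≤ _ := by
        rw [Finset.sum_const, nsmul_eq_mul, mul_pow]
        gcongr
        exact_mod_cast card_nodesAt_le n

/-- The series `∑ cⁿ #Sₙ` has finite expectation by comparison with a geometric series, so almost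
surely it converges. -/
lemma ae_tendsto_pow_mul_ncard_survivors (p : unitInterval) {c : ℝ≥0∞}
    (hc : c * (M * ENNReal.ofReal p) < 1) :
    ∀ᵐ X ∂(treeMeasure fun _ : Fin M => p),
      Filter.Tendsto (fun n => c ^ n * ((survivors X n).ncard : ℝ≥0∞)) Filter.atTop (nhds 0) := by
  have hm : ∀ n, Measurable fun X : LabeledTree M => c ^ n * ((survivors X n).ncard : ℝ≥0∞) :=
    fun n => (measurable_ncard_survivors n).const_mul _
  have hfin : ∫⁻ X, ∑' n, c ^ n * ((survivors X n).ncard : ℝ≥0∞)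
      ∂(treeMeasure fun _ : Fin M => p) ≠ ∞ := by
    rw [lintegral_tsum fun n => (hm n).aemeasurable]
    refine ne_top_of_le_ne_top ?_ (ENNReal.tsum_le_tsum
      (g := fun n => (c * (M * ENNReal.ofReal p)) ^ n) fun n => ?_)
    · rw [ENNReal.tsum_geometric]
      exact ENNReal.inv_ne_top.2 (tsub_pos_of_lt hc).ne'
    · rw [lintegral_const_mul _ (measurable_ncard_survivors n), mul_pow]
      gcongr
      exact lintegral_ncard_survivors_le p n
  filter_upwards [ae_lt_top (Measurable.tsum hm) hfin] with X hX
  exact ENNReal.tendsto_atTop_zero_of_tsum_ne_top hX.ne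

/-! ### Upper bounds -/

lemma ediam_madicInterval (v : List (Fin M)) :
    Metric.ediam (madicInterval v) = ENNReal.ofReal ((M : ℝ)⁻¹ ^ v.length) := by
  rw [madicInterval, Real.ediam_Icc]
  simp

lemma dimH_randomCantorSet_le_of_tendsto (hM : 2 ≤ M) {X : LabeledTree M} {s : ℝ≥0}
    (h : Filter.Tendsto (fun n => ENNReal.ofReal ((M : ℝ) ^ (-(s : ℝ))) ^ n *
      ((survivors X n).ncard : ℝ≥0∞)) Filter.atTop (nhds 0)) :
    dimH (randomCantorSet X) ≤ s := by
  have hM0 : 0 < M := by omega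
  have hM1 : (M : ℝ)⁻¹ < 1 := inv_lt_one_of_one_lt₀ (by exact_mod_cast hM)
  have hMR : (0 : ℝ) < (M : ℝ)⁻¹ := by positivity
  have hfin := fun n => (finite_survivors X n).fintype
  have hle := Measure.hausdorffMeasure_le_liminf_sum (s : ℝ) (randomCantorSet X)
    (l := Filter.atTop) (ι := fun n => survivors X n)
    (fun n : ℕ => ENNReal.ofReal ((M : ℝ)⁻¹ ^ n))
    (by
      have := ENNReal.tendsto_ofReal (tendsto_pow_atTop_nhds_zero_of_lt_one hMR.le hM1)
      simpa using this)
    (fun n v => madicInterval v.1)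
    (.of_forall fun n v => by rw [ediam_madicInterval, v.2.1])
    (.of_forall fun n => by
      have := randomCantorSet_subset_levelSet hM0 X n
      rwa [levelSet, Set.biUnion_eq_iUnion] at this)
  have hsum : ∀ n, ∑ v : survivors X n, Metric.ediam (madicInterval v.1) ^ (s : ℝ) =
      ENNReal.ofReal ((M : ℝ) ^ (-(s : ℝ))) ^ n * ((survivors X n).ncard : ℝ≥0∞) := by
    intro n
    have : ∀ v : survivors X n, Metric.ediam (madicInterval v.1) ^ (s : ℝ) =
        ENNReal.ofReal ((M : ℝ) ^ (-(s : ℝ))) ^ n := by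
      intro v
      rw [ediam_madicInterval, v.2.1, ENNReal.ofReal_rpow_of_pos (by positivity),
        ← ENNReal.ofReal_pow (by positivity)]
      congr 1
      rw [← Real.rpow_natCast, ← Real.rpow_natCast, ← Real.rpow_mul hMR.le, Real.inv_rpow (by positivity),
        ← Real.rpow_neg (by positivity), ← Real.rpow_mul (by positivity)]
      ring_nf
    rw [Finset.sum_congr rfl fun v _ => this v, Finset.sum_const, Finset.card_univ, nsmul_eq_mul,
      mul_comm, ← Nat.card_eq_fintype_card, Nat.card_coe_set_eq]
  simp only [hsum, h.liminf_eq, nonpos_iff_eq_zero] at hle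
  exact dimH_le_of_hausdorffMeasure_ne_top (by rw [hle]; simp)

/-- Squaring expresses the first-moment condition through `M p²`: `(M⁻ˢ M p)² = M¹⁻²ˢ · M p²`. -/
lemma ofReal_rpow_neg_mul_lt_one (hM : 2 ≤ M) {p : unitInterval} {s : ℝ}
    (h : (M : ℝ) ^ (1 - 2 * s) * (M * (p : ℝ) ^ 2) < 1) :
    ENNReal.ofReal ((M : ℝ) ^ (-s)) * (M * ENNReal.ofReal p) < 1 := by
  have hMR : (0 : ℝ) < M := by exact_mod_cast (by omega : 0 < M)
  rw [← ENNReal.ofReal_natCast, ← ENNReal.ofReal_mul hMR.le, ← ENNReal.ofReal_mul (by positivity),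
    ENNReal.ofReal_lt_one]
  have h0 : 0 ≤ (M : ℝ) ^ (-s) * (M * p) := mul_nonneg (by positivity) (mul_nonneg hMR.le p.2.1)
  refine (sq_lt_one_iff₀ h0).1 (lt_of_eq_of_lt ?_ h)
  have : (M : ℝ) ^ (1 - 2 * s) = M * ((M : ℝ) ^ (-s)) ^ 2 := by
    rw [← Real.rpow_natCast, ← Real.rpow_mul hMR.le, sub_eq_add_neg, Real.rpow_add hMR,
      Real.rpow_one]
    congr 2
    push_cast; ring
  rw [this]
  ring

lemma ae_dimH_randomCantorSet_le_half (hM : 2 ≤ M) {p : unitInterval}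
    (hp : (M : ℝ) * (p : ℝ) ^ 2 ≤ 1) :
    ∀ᵐ X ∂(treeMeasure fun _ : Fin M => p), dimH (randomCantorSet X) ≤ 1 / 2 := by
  have hM1 : (1 : ℝ) < M := by exact_mod_cast hM
  -- Exponents strictly above `1/2` are needed because at `M p² = 1` the first moment does not decay
  -- for `s = 1/2`.
  have h : ∀ k : ℕ, ∀ᵐ X ∂(treeMeasure fun _ : Fin M => p),
      dimH (randomCantorSet X) ≤ ((1 / 2 + 1 / (k + 1 : ℝ≥0) : ℝ≥0) : ℝ≥0∞) := by
    intro k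
    have hc : ENNReal.ofReal ((M : ℝ) ^ (-((1 / 2 + 1 / (k + 1 : ℝ≥0) : ℝ≥0) : ℝ))) *
        (M * ENNReal.ofReal p) < 1 := by
      refine ofReal_rpow_neg_mul_lt_one hM ?_
      have h1 : (M : ℝ) ^ (1 - 2 * ((1 / 2 + 1 / (k + 1 : ℝ≥0) : ℝ≥0) : ℝ)) < 1 := by
        refine Real.rpow_lt_one_of_one_lt_of_neg hM1 ?_
        push_cast
        have : (0 : ℝ) < 1 / (k + 1) := by positivity
        linarith
      have h2 : 0 ≤ (M : ℝ) ^ (1 - 2 * ((1 / 2 + 1 / (k + 1 : ℝ≥0) : ℝ≥0) : ℝ)) := by positivity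
      exact (mul_le_of_le_one_right h2 hp).trans_lt h1
    filter_upwards [ae_tendsto_pow_mul_ncard_survivors p hc] with X hX
    exact dimH_randomCantorSet_le_of_tendsto hM hX
  filter_upwards [ae_all_iff.2 h] with X hX
  have hlim : Filter.Tendsto (fun k : ℕ => ((1 / 2 + 1 / (k + 1 : ℝ≥0) : ℝ≥0) : ℝ≥0∞))
      Filter.atTop (nhds ((1 / 2 + 0 : ℝ≥0) : ℝ≥0∞)) := by
    rw [ENNReal.tendsto_coe]
    exact tendsto_const_nhds.add tendsto_one_div_add_atTop_nhds_zero_nat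
  have := ge_of_tendsto' hlim hX
  simpa using this

lemma volume_randomCantorSet_sub_le (hM : 2 ≤ M) (X Y : LabeledTree M) (n : ℕ) :
    volume (randomCantorSet Y - randomCantorSet X) ≤
      ((survivors X n).ncard : ℝ≥0∞) * ((survivors Y n).ncard : ℝ≥0∞) *
        ENNReal.ofReal (2 * (M : ℝ)⁻¹ ^ n) := by
  have hM0 : 0 < M := by omega
  have hX := finite_survivors X n
  have hY := finite_survivors Y n
  let J : List (Fin M) × List (Fin M) → Set ℝ := fun z =>
    Set.Icc (leftEnd z.2 - leftEnd z.1 - (M : ℝ)⁻¹ ^ n) (leftEnd z.2 - leftEnd z.1 + (M : ℝ)⁻¹ ^ n)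
  have hsub : randomCantorSet Y - randomCantorSet X ⊆
      ⋃ z ∈ hX.toFinset ×ˢ hY.toFinset, J z := by
    rintro _ ⟨y, hy, x, hx, rfl⟩
    have hy := randomCantorSet_subset_levelSet hM0 Y n hy
    have hx := randomCantorSet_subset_levelSet hM0 X n hx
    simp only [levelSet, Set.mem_iUnion, exists_prop] at hx hy
    obtain ⟨v, hv, hx⟩ := hx
    obtain ⟨w, hw, hy⟩ := hy
    rw [madicInterval, hv.1, one_div, ← inv_pow] at hx
    rw [madicInterval, hw.1, one_div, ← inv_pow] at hy
    simp only [Set.mem_iUnion, exists_prop]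
    refine ⟨(v, w), by simp [hv, hw], ?_, ?_⟩
    · show leftEnd w - leftEnd v - (M : ℝ)⁻¹ ^ n ≤ y - x
      linarith [hx.2, hy.1]
    · show y - x ≤ leftEnd w - leftEnd v + (M : ℝ)⁻¹ ^ n
      linarith [hx.1, hy.2]
  calc _ ≤ ∑ z ∈ hX.toFinset ×ˢ hY.toFinset, volume (J z) :=
        (measure_mono hsub).trans (measure_biUnion_finset_le _ _)
    _ = ∑ z ∈ hX.toFinset ×ˢ hY.toFinset, ENNReal.ofReal (2 * (M : ℝ)⁻¹ ^ n) := by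
        refine Finset.sum_congr rfl fun z _ => ?_
        rw [Real.volume_Icc]
        ring_nf
    _ = _ := by
        rw [Finset.sum_const, Finset.card_product, nsmul_eq_mul, Set.ncard_eq_toFinset_card _ hX,
          Set.ncard_eq_toFinset_card _ hY]
        push_cast
        rfl

lemma ae_not_containsInterval_sub (hM : 2 ≤ M) {p : unitInterval}
    (hp : (M : ℝ) * (p : ℝ) ^ 2 < 1) :
    ∀ᵐ X ∂((treeMeasure fun _ : Fin M => p).prod (treeMeasure fun _ : Fin M => p)),
      ¬ ContainsInterval (randomCantorSet X.2 - randomCantorSet X.1) := by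
  have hMR : (0 : ℝ) < M := by exact_mod_cast (by omega : 0 < M)
  have hc : ENNReal.ofReal ((M : ℝ) ^ (-(1 / 2 : ℝ))) * (M * ENNReal.ofReal p) < 1 := by
    refine ofReal_rpow_neg_mul_lt_one hM ?_
    norm_num
    exact hp
  have h := ae_tendsto_pow_mul_ncard_survivors p hc
  filter_upwards [Measure.quasiMeasurePreserving_fst.ae h,
    Measure.quasiMeasurePreserving_snd.ae h] with X h1 h2
  rintro ⟨a, b, hab, hsub⟩
  have hlim := ENNReal.Tendsto.const_mul (a := 2)
    (ENNReal.Tendsto.mul h1 (by simp) h2 (by simp)) (by simp)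
  simp only [mul_zero] at hlim
  have hle : ENNReal.ofReal (b - a) ≤ 0 := by
    refine ge_of_tendsto' hlim fun n => ?_
    rw [← Real.volume_Icc]
    refine (measure_mono hsub).trans ((volume_randomCantorSet_sub_le hM X.1 X.2 n).trans_eq ?_)
    -- The length is shared out as one factor `M^(-n/2)` for each tree.
    have : ENNReal.ofReal (2 * (M : ℝ)⁻¹ ^ n) = 2 * (ENNReal.ofReal ((M : ℝ) ^ (-(1 / 2 : ℝ))) ^ n *
        ENNReal.ofReal ((M : ℝ) ^ (-(1 / 2 : ℝ))) ^ n) := by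
      rw [← mul_pow, ← ENNReal.ofReal_mul (by positivity), ← Real.rpow_add hMR,
        ENNReal.ofReal_mul (by norm_num), ENNReal.ofReal_pow (by positivity)]
      norm_num [Real.rpow_neg_one]
    rw [this]
    ring
  rw [nonpos_iff_eq_zero, ENNReal.ofReal_eq_zero] at hle
  linarith

/-! ### Hitting probabilities and lower bounds on the dimension -/

/-- The probability that the random Cantor set with parameter `q` hits a given set. -/
noncomputable def hittingMeasure (M : ℕ) (q : unitInterval) : OuterMeasure ℝ where
  measureOf A := (treeMeasure fun _ : Fin M => q) {Y | (randomCantorSet Y ∩ A).Nonempty}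
  empty := by simp
  mono h := measure_mono fun _ hY => hY.mono (Set.inter_subset_inter_right _ h)
  iUnion_nat A _ := by
    refine (measure_mono fun Y hY => ?_).trans (measure_iUnion_le _)
    obtain ⟨x, hx, hxA⟩ := hY
    obtain ⟨i, hi⟩ := Set.mem_iUnion.1 hxA
    exact Set.mem_iUnion.2 ⟨i, x, hx, hi⟩

lemma hittingMeasure_le_pow (hM : 0 < M) (q : unitInterval) {U : Set ℝ} {n : ℕ}
    (hU : Metric.ediam U ≤ ENNReal.ofReal ((M : ℝ)⁻¹ ^ n)) :
    hittingMeasure M q U ≤ 4 * ENNReal.ofReal q ^ n := by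
  classical
  rcases U.eq_empty_or_nonempty with rfl | ⟨x₀, hx₀⟩
  · simp
  have hMR : (0 : ℝ) < M := by exact_mod_cast hM
  have hpos : (0 : ℝ) < (M : ℝ) ^ n := by positivity
  let s := (nodesAt M n).filter fun v => (madicInterval v ∩ U).Nonempty
  let y := x₀ * (M : ℝ) ^ n
  have hs : s.card ≤ 4 := by
    -- In units of `M⁻ⁿ`, a point of `U` is within `1` of `y` and within `1` to the right of its
    -- interval's index, so the index lies in `[y - 2, y + 1]`.
    calc s.card ≤ (Finset.Icc (⌈y⌉ - 2) (⌊y⌋ + 1)).card := by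
          refine Finset.card_le_card_of_injOn (fun v => (index v : ℤ)) (fun v hv => ?_)
            fun v hv w hw h => ?_
          · obtain ⟨hv, x, hxv, hxU⟩ := Finset.mem_filter.1 hv
            rw [mem_nodesAt] at hv
            rw [madicInterval, leftEnd_eq_index_div hM, hv, ← add_div] at hxv
            have hd : dist x x₀ ≤ (M : ℝ)⁻¹ ^ n := by
              rw [← ENNReal.ofReal_le_ofReal_iff (by positivity), ← edist_dist]
              exact (Metric.edist_le_ediam_of_mem hxU hx₀).trans hU
            rw [Real.dist_eq, inv_pow, ← one_div, le_div_iff₀ hpos] at hd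
            have h1 := (div_le_iff₀ hpos).1 hxv.1
            have h2 := (le_div_iff₀ hpos).1 hxv.2
            have h3 : |x * (M : ℝ) ^ n - y| ≤ 1 := by
              rwa [← sub_mul, abs_mul, abs_of_pos hpos]
            rw [abs_le] at h3
            simp only [Finset.coe_Icc, Set.mem_Icc]
            constructor
            · rw [sub_le_iff_le_add, Int.ceil_le]
              push_cast
              linarith
            · rw [← sub_le_iff_le_add, Int.le_floor]
              push_cast
              linarith
          · have hv := mem_nodesAt.1 (Finset.mem_filter.1 hv).1
            have hw := mem_nodesAt.1 (Finset.mem_filter.1 hw).1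
            exact index_injective_of_length_eq (hv.trans hw.symm) (Int.natCast_inj.1 h)
      _ ≤ 4 := by
          rw [Int.card_Icc]
          have := Int.floor_le_ceil y
          omega
  calc hittingMeasure M q U
      ≤ (treeMeasure fun _ : Fin M => q) (⋃ v ∈ s, {Y | v ∈ survivors Y n}) := by
        refine measure_mono fun Y hY => ?_
        obtain ⟨x, hx, hxU⟩ := hY
        have hx := randomCantorSet_subset_levelSet hM Y n hx
        simp only [levelSet, Set.mem_iUnion, exists_prop] at hx
        obtain ⟨v, hv, hx⟩ := hx
        simp only [Set.mem_iUnion, exists_prop]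
        exact ⟨v, Finset.mem_filter.2 ⟨mem_nodesAt.2 hv.1, x, hx, hxU⟩, hv⟩
    _ ≤ ∑ v ∈ s, (treeMeasure fun _ : Fin M => q) {Y | v ∈ survivors Y n} :=
        measure_biUnion_finset_le _ _
    _ = s.card * ENNReal.ofReal q ^ n := by
        rw [Finset.sum_congr rfl fun v hv => treeMeasure_mem_survivors q
          (mem_nodesAt.1 (Finset.mem_filter.1 hv).1), Finset.sum_const, nsmul_eq_mul]
    _ ≤ _ := by
        gcongr
        exact_mod_cast hs

lemma hittingMeasure_le_ediam_rpow (hM : 2 ≤ M) {q : unitInterval} {s : ℝ} (hs : 0 < s)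
    (hq : (q : ℝ) = (M : ℝ) ^ (-s)) {U : Set ℝ} (hU : Metric.ediam U ≤ 1) :
    hittingMeasure M q U ≤ ENNReal.ofReal (4 * (M : ℝ) ^ s) * Metric.ediam U ^ s := by
  have hM0 : 0 < M := by omega
  have hM1 : (1 : ℝ) < M := by exact_mod_cast hM
  have hMR : (0 : ℝ) < M := by linarith
  rcases eq_or_ne (Metric.ediam U) 0 with h0 | h0
  · have hq1 : ENNReal.ofReal q < 1 := by
      rw [ENNReal.ofReal_lt_one, hq]
      exact Real.rpow_lt_one_of_one_lt_of_neg hM1 (by linarith)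
    have hlim : Filter.Tendsto (fun n : ℕ => 4 * ENNReal.ofReal q ^ n) Filter.atTop (nhds 0) := by
      have := ENNReal.Tendsto.const_mul (a := 4)
        (ENNReal.tendsto_pow_atTop_nhds_zero_of_lt_one hq1) (by simp)
      simpa using this
    have := ge_of_tendsto' hlim fun n => hittingMeasure_le_pow hM0 q (U := U) (n := n)
      (by simp [h0])
    exact this.trans (by simp)
  · have htop : Metric.ediam U ≠ ∞ := ne_top_of_le_ne_top (by simp) hU
    obtain ⟨d, hd⟩ : ∃ d : ℝ, d = (Metric.ediam U).toReal := ⟨_, rfl⟩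
    have hdU : Metric.ediam U = ENNReal.ofReal d := by rw [hd, ENNReal.ofReal_toReal htop]
    have hd0 : 0 < d := hd ▸ ENNReal.toReal_pos h0 htop
    have hd1 : d ≤ 1 := by rwa [hdU, ENNReal.ofReal_le_one] at hU
    -- With `M⁻⁽ⁿ⁺¹⁾ < d ≤ M⁻ⁿ`, the bound `qⁿ = M⁻ⁿˢ` is at most `Mˢ dˢ`; rounding costs the factor
    -- `Mˢ`.
    obtain ⟨n, hn1, hn2⟩ := exists_nat_pow_near_of_lt_one hd0 hd1 (y := (M : ℝ)⁻¹) (by positivity)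
      (inv_lt_one_of_one_lt₀ hM1)
    refine (hittingMeasure_le_pow hM0 q (n := n) ?_).trans ?_
    · rw [hdU]
      exact ENNReal.ofReal_le_ofReal hn2
    · rw [hdU, ENNReal.ofReal_rpow_of_pos hd0, ← ENNReal.ofReal_mul (by positivity),
        ← ENNReal.ofReal_pow q.2.1, show (4 : ℝ≥0∞) = ENNReal.ofReal 4 by simp,
        ← ENNReal.ofReal_mul (by norm_num), mul_assoc]
      refine ENNReal.ofReal_le_ofReal (mul_le_mul_of_nonneg_left ?_ (by norm_num))
      calc (q : ℝ) ^ n = (M : ℝ) ^ s * ((M : ℝ)⁻¹ ^ (n + 1)) ^ s := by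
            rw [hq, ← Real.rpow_natCast, ← Real.rpow_natCast, ← Real.rpow_mul hMR.le,
              ← Real.rpow_neg_one, ← Real.rpow_mul hMR.le, ← Real.rpow_mul hMR.le,
              ← Real.rpow_add hMR]
            congr 1
            push_cast
            ring
        _ ≤ (M : ℝ) ^ s * d ^ s := by gcongr

/-- Hausdorff measure dominates every outer measure bounded by `(diam U)ˢ` on small sets. Using an
outer measure avoids measurability of hitting events. -/
lemma hittingMeasure_eq_zero_of_dimH_lt (hM : 2 ≤ M) {q : unitInterval} {s : ℝ≥0} (hs : 0 < s)
    (hq : (q : ℝ) = (M : ℝ) ^ (-(s : ℝ))) {A : Set ℝ} (hA : dimH A < s) :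
    hittingMeasure M q A = 0 := by
  have hMR : (0 : ℝ) < M := by exact_mod_cast (by omega : 0 < M)
  have hC0 : ENNReal.ofReal (4 * (M : ℝ) ^ (s : ℝ)) ≠ 0 := by
    rw [ne_eq, ENNReal.ofReal_eq_zero, not_le]
    positivity
  have hle : (ENNReal.ofReal (4 * (M : ℝ) ^ (s : ℝ)))⁻¹ • hittingMeasure M q ≤
      OuterMeasure.mkMetric fun r => r ^ (s : ℝ) := by
    refine OuterMeasure.le_mkMetric _ _ 1 one_pos fun U hU => ?_
    rw [smul_apply, smul_eq_mul, ENNReal.inv_mul_le_iff hC0 ENNReal.ofReal_ne_top]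
    exact hittingMeasure_le_ediam_rpow hM hs hq hU
  have h0 : (OuterMeasure.mkMetric fun r => r ^ (s : ℝ) : OuterMeasure ℝ) A = 0 := by
    have := hausdorffMeasure_of_dimH_lt hA
    rwa [Measure.hausdorffMeasure, ← Measure.toOuterMeasure_apply,
      Measure.mkMetric_toOuterMeasure] at this
  have := (hle A).trans_eq h0
  rw [smul_apply, smul_eq_mul, nonpos_iff_eq_zero, mul_eq_zero] at this
  exact this.resolve_left (ENNReal.inv_ne_zero.2 ENNReal.ofReal_ne_top)

/-- If `M p M⁻ˢ > 1`, then the random Cantor set has dimension at least `s` with positive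
probability. -/
lemma exists_measurableSet_le_dimH (hM : 2 ≤ M) {p : unitInterval} {s : ℝ≥0} (hs : 0 < s)
    (hps : 1 < (M : ℝ) * (p * (M : ℝ) ^ (-(s : ℝ)))) :
    ∃ E : Set (LabeledTree M), MeasurableSet E ∧ (treeMeasure fun _ : Fin M => p) E ≠ 0 ∧
      (∀ X X' : LabeledTree M, (∀ u ≠ [], X u = X' u) → X ∈ E → X' ∈ E) ∧
      ∀ X ∈ E, s ≤ dimH (randomCantorSet X) := by
  have hM1 : (1 : ℝ) < M := by exact_mod_cast hM
  let q : unitInterval := ⟨(M : ℝ) ^ (-(s : ℝ)), by positivity,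
    Real.rpow_le_one_of_one_le_of_nonpos hM1.le (by simp)⟩
  obtain ⟨n₀, θ, N, hθ, hN, hG⟩ := exists_forestMeasure_iInter_richForests_ne_zero hM (p := p)
    (q := q) hps
  set G := ⋂ m, richForests M n₀ θ N m
  have hGm : MeasurableSet G := .iInter fun m => measurableSet_richForests _ _ _ _
  let D : Set (LabeledTree M × LabeledTree M) := {X | (Sum.elim X.1 X.2 : LabeledForest M) ∈ G}
  have hDm : MeasurableSet D := measurable_sumElim hGm
  -- The `p`-trees that form a rich pair with a random `q`-tree with positive probability: a
  -- measurable substitute for the event `s ≤ dimH`.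
  refine ⟨{X | (treeMeasure fun _ : Fin M => q) (Prod.mk X ⁻¹' D) ≠ 0},
    (measurable_measure_prodMk_left hDm) (measurableSet_singleton 0).compl, ?_, ?_, ?_⟩
  · intro h0
    rw [← map_sumElim_treeMeasure, Measure.map_apply measurable_sumElim hGm] at hG
    exact hG ((Measure.measure_prod_null hDm).2 (ae_iff.2 h0))
  · intro X X' h hX hX'
    refine hX (measure_mono_null (fun Y hY => ?_) hX')
    refine Set.mem_iInter.2 fun m => richForests_congr (fun x hx _ => ?_) (Set.mem_iInter.1 hY m)
    rcases x with u | u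
    · exact h u (by rintro rfl; exact hx rfl)
    · rfl
  · intro X hX
    by_contra! hlt
    refine hX (measure_mono_null (fun Y hY => ?_) (hittingMeasure_eq_zero_of_dimH_lt hM hs
      (q := q) rfl hlt))
    -- Only the point `0` of the interval is used: it says that the two sets intersect.
    have := Icc_subset_randomCantorSet_sub hM hθ hN hY
      (show (0 : ℝ) ∈ _ from ⟨le_rfl, by positivity⟩)
    obtain ⟨y, hy, x, hx, hxy⟩ := this
    obtain rfl : y = x := sub_eq_zero.1 hxy
    exact ⟨y, hy, hx⟩

lemma ae_le_dimH_randomCantorSet (hM : 2 ≤ M) {p : unitInterval} {s : ℝ≥0} (hs : 0 < s)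
    (hps : 1 < (M : ℝ) * (p * (M : ℝ) ^ (-(s : ℝ)))) :
    ∀ᵐ ω ∂forestMeasure M p p, (∀ n, (survivors ω.left n).Nonempty) →
      (∀ n, (survivors ω.right n).Nonempty) →
      s ≤ dimH (randomCantorSet ω.left) ∧ s ≤ dimH (randomCantorSet ω.right) := by
  have hM0 : 0 < M := by omega
  obtain ⟨E, hE, hE0, hroot, hdim⟩ := exists_measurableSet_le_dimH hM hs hps
  have hl := ae_exists_graft_mem p p (G := LabeledForest.left ⁻¹' E) (measurable_left hE) (by
    rw [← map_sumElim_treeMeasure, Measure.map_apply measurable_sumElim (measurable_left hE)]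
    have : (fun X : LabeledTree M × LabeledTree M => (Sum.elim X.1 X.2 : LabeledForest M)) ⁻¹'
      (LabeledForest.left ⁻¹' E) = E ×ˢ Set.univ := Set.prod_univ.symm
    rw [this, Measure.prod_prod]
    simpa using hE0)
    fun ω ω' h hω => hroot _ _ (fun u hu => h (.inl u) (by simpa [nodeLength] using hu)) hω
  have hr := ae_exists_graft_mem p p (G := LabeledForest.right ⁻¹' E) (measurable_right hE) (by
    rw [← map_sumElim_treeMeasure, Measure.map_apply measurable_sumElim (measurable_right hE)]
    have : (fun X : LabeledTree M × LabeledTree M => (Sum.elim X.1 X.2 : LabeledForest M)) ⁻¹'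
      (LabeledForest.right ⁻¹' E) = Set.univ ×ˢ E := Set.univ_prod.symm
    rw [this, Measure.prod_prod]
    simpa using hE0)
    fun ω ω' h hω => hroot _ _ (fun u hu => h (.inr u) (by simpa [nodeLength] using hu)) hω
  filter_upwards [hl, hr] with ω h1 h2 hs1 hs2
  obtain ⟨n, v, w, hv, -, hG⟩ := h1 hs1 hs2
  obtain ⟨n', v', w', -, hw', hG'⟩ := h2 hs1 hs2
  rw [Set.mem_preimage, left_graft] at hG
  rw [Set.mem_preimage, right_graft] at hG'
  exact ⟨(hdim _ hG).trans (dimH_randomCantorSet_graft_le hM0 hv),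
    (hdim _ hG').trans (dimH_randomCantorSet_graft_le hM0 hw')⟩

lemma ae_half_le_dimH_randomCantorSet (hM : 2 ≤ M) {p : unitInterval}
    (hp : 1 ≤ (M : ℝ) * (p : ℝ) ^ 2) :
    ∀ᵐ ω ∂forestMeasure M p p, (∀ n, (survivors ω.left n).Nonempty) →
      (∀ n, (survivors ω.right n).Nonempty) →
      1 / 2 ≤ dimH (randomCantorSet ω.left) ∧ 1 / 2 ≤ dimH (randomCantorSet ω.right) := by
  have hM1 : (1 : ℝ) < M := by exact_mod_cast hM
  have hMR : (0 : ℝ) < M := by linarith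
  -- Exponents strictly below `1/2` make `M p M⁻ˢ > 1` strict even at criticality.
  obtain ⟨u, -, hu, hlim⟩ := exists_seq_strictMono_tendsto' (show (0 : ℝ≥0) < 1 / 2 by norm_num)
  have h : ∀ k, ∀ᵐ ω ∂forestMeasure M p p, (∀ n, (survivors ω.left n).Nonempty) →
      (∀ n, (survivors ω.right n).Nonempty) →
      u k ≤ dimH (randomCantorSet ω.left) ∧ u k ≤ dimH (randomCantorSet ω.right) := by
    intro k
    refine ae_le_dimH_randomCantorSet hM (hu k).1 ?_
    have h0 : 0 ≤ (M : ℝ) * (p * (M : ℝ) ^ (-(u k : ℝ))) :=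
      mul_nonneg hMR.le (mul_nonneg p.2.1 (by positivity))
    refine (one_lt_sq_iff₀ h0).1 ?_
    have h1 : 1 < (M : ℝ) ^ (1 - 2 * (u k : ℝ)) := by
      refine Real.one_lt_rpow hM1 ?_
      have : (u k : ℝ) < 1 / 2 := by exact_mod_cast (hu k).2
      linarith
    have h2 : (M : ℝ) ^ (1 - 2 * (u k : ℝ)) = M * ((M : ℝ) ^ (-(u k : ℝ))) ^ 2 := by
      rw [← Real.rpow_natCast, ← Real.rpow_mul hMR.le, sub_eq_add_neg, Real.rpow_add hMR,
        Real.rpow_one]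
      congr 2
      push_cast; ring
    calc 1 < (M : ℝ) * p ^ 2 * (M : ℝ) ^ (1 - 2 * (u k : ℝ)) := one_lt_mul_of_le_of_lt hp h1
      _ = _ := by rw [h2]; ring
  filter_upwards [ae_all_iff.2 h] with ω hω h1 h2
  have hlim' : Filter.Tendsto (fun k => (u k : ℝ≥0∞)) Filter.atTop (nhds (1 / 2)) := by
    have := ENNReal.tendsto_coe.2 hlim
    simpa using this
  exact ⟨le_of_tendsto' hlim' fun k => (hω k h1 h2).1, le_of_tendsto' hlim' fun k => (hω k h1 h2).2⟩

/-! ### Intervals in the difference set -/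

lemma ae_containsInterval_sub (hM : 2 ≤ M) {p q : unitInterval}
    (hpq : 1 < (M : ℝ) * (p * q)) :
    ∀ᵐ ω ∂forestMeasure M p q, (∀ n, (survivors ω.left n).Nonempty) →
      (∀ n, (survivors ω.right n).Nonempty) →
      ContainsInterval (randomCantorSet ω.right - randomCantorSet ω.left) := by
  have hM0 : 0 < M := by omega
  obtain ⟨n₀, θ, N, hθ, hN, hG⟩ := exists_forestMeasure_iInter_richForests_ne_zero hM hpq
  have h := ae_exists_graft_mem p q (.iInter fun m => measurableSet_richForests n₀ θ N m) hG
    fun ω ω' h hω => Set.mem_iInter.2 fun m =>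
      richForests_congr (fun x hx _ => h x hx) (Set.mem_iInter.1 hω m)
  filter_upwards [h] with ω hω h1 h2
  obtain ⟨n, v, w, hv, hw, hG⟩ := hω h1 h2
  have hsub := Icc_subset_randomCantorSet_sub hM hθ hN hG
  rw [left_graft, right_graft] at hsub
  exact containsInterval_sub_of_graft hM0 hv hw ⟨0, 1 / (M : ℝ) ^ n₀, by positivity, hsub⟩

end MandelbrotPercolation

open MandelbrotPercolation MeasureTheory in
theorem corollary1 (M : ℕ) (hM : 2 ≤ M) (p : unitInterval) :
    ∀ᵐ X ∂((treeMeasure fun _ : Fin M => p).prod (treeMeasure fun _ : Fin M => p)),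
      (randomCantorSet X.1).Nonempty → (randomCantorSet X.2).Nonempty →
        (dimH (randomCantorSet X.1) + dimH (randomCantorSet X.2) < 1 →
          ¬ ContainsInterval (randomCantorSet X.2 - randomCantorSet X.1)) ∧
        (1 < dimH (randomCantorSet X.1) + dimH (randomCantorSet X.2) →
          ContainsInterval (randomCantorSet X.2 - randomCantorSet X.1)) := by
  have hM0 : 0 < M := by omega
  have transfer : ∀ {Q : LabeledForest M → Prop}, (∀ᵐ ω ∂forestMeasure M p p, Q ω) →
      ∀ᵐ X ∂((treeMeasure fun _ : Fin M => p).prod (treeMeasure fun _ : Fin M => p)),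
        Q (Sum.elim X.1 X.2) := fun h =>
    ae_of_ae_map measurable_sumElim.aemeasurable (by rwa [map_sumElim_treeMeasure])
  have hlower : 1 ≤ (M : ℝ) * (p : ℝ) ^ 2 →
      ∀ᵐ X ∂((treeMeasure fun _ : Fin M => p).prod (treeMeasure fun _ : Fin M => p)),
      (randomCantorSet X.1).Nonempty → (randomCantorSet X.2).Nonempty →
        1 ≤ dimH (randomCantorSet X.1) + dimH (randomCantorSet X.2) := fun hp => by
    filter_upwards [transfer (ae_half_le_dimH_randomCantorSet hM hp)] with X hX h1 h2
    have := hX (survivors_nonempty_of_randomCantorSet hM0 h1)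
      (survivors_nonempty_of_randomCantorSet hM0 h2)
    rw [← ENNReal.add_halves 1]
    exact add_le_add this.1 this.2
  have hupper : (M : ℝ) * (p : ℝ) ^ 2 ≤ 1 →
      ∀ᵐ X ∂((treeMeasure fun _ : Fin M => p).prod (treeMeasure fun _ : Fin M => p)),
        dimH (randomCantorSet X.1) + dimH (randomCantorSet X.2) ≤ 1 := fun hp => by
    have h := ae_dimH_randomCantorSet_le_half hM hp
    filter_upwards [Measure.quasiMeasurePreserving_fst.ae h,
      Measure.quasiMeasurePreserving_snd.ae h] with X h1 h2
    rw [← ENNReal.add_halves 1]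
    exact add_le_add h1 h2
  -- In each regime the dimension bounds refute every hypothesis that the interval results do not
  -- serve; at equality they refute both.
  rcases lt_trichotomy ((M : ℝ) * (p : ℝ) ^ 2) 1 with hp | hp | hp
  · filter_upwards [hupper hp.le, ae_not_containsInterval_sub hM hp] with X h1 h2 _ _
    exact ⟨fun _ => h2, fun h => absurd h (not_lt.2 h1)⟩
  · filter_upwards [hupper hp.le, hlower hp.ge] with X h1 h2 hX hY
    exact ⟨fun h => absurd h (not_lt.2 (h2 hX hY)), fun h => absurd h (not_lt.2 h1)⟩
  · filter_upwards [hlower hp.le, transfer (ae_containsInterval_sub hM (p := p) (q := p)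
      (by rwa [← pow_two]))] with X h1 h2 hX hY
    exact ⟨fun h => absurd h (not_lt.2 (h1 hX hY)),
      fun _ => h2 (survivors_nonempty_of_randomCantorSet hM0 hX)
        (survivors_nonempty_of_randomCantorSet hM0 hY)⟩
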